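/- Let $N\ge 1$, let $g=\mathrm{diag}(-1,1,1,1)$ be the Minkowski metric on $\mathbb R^4$, and for a real function $F(X_0,\dots,X_N)$ write $F_{m,n}=\partial^2F/\partial X_m\partial X_n$. For Lagrange multipliers $\lambda,\lambda_\mu,\lambda_{\mu_1\mu_2},\dots,\lambda_{\mu_1\cdots\mu_N}$ put $$A^{\alpha\alpha_1\cdots\alpha_m\beta_1\cdots\beta_n}=\int_{\mathbb R^3}F_{m,n}(\lambda,\lambda_\mu p^\mu,\dots,\lambda_{\mu_1\cdots\mu_N}p^{\mu_1}\cdots p^{\mu_N})\,p^\alpha p^{\alpha_1}\cdots p^{\alpha_m}p^{\beta_1}\cdots p^{\beta_n}\,\frac{dp^1dp^2dp^3}{p^0},\qquad p^0=|\vec p|.$$ Consider the state in which $\lambda_{\mu_1\cdots\mu_n}=0$ for $n\ge 2$ and $\lambda_\mu\lambda^\mu<0$, $\lambda_0>0$ (so that $\lambda_\mu p^\mu>0$); put $\gamma=\sqrt{-\lambda_\mu\lambda^\mu}$, $u_\alpha=\gamma^{-1}\lambda_\alpha$, $h_{\alpha\beta}=g_{\alpha\beta}+u_\alpha u_\beta$.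 Let $\xi_\alpha\xi^\alpha=-1$, $\eta_\alpha\eta^\alpha=1$, $\eta_\alpha\xi^\alpha=0$, and for real $c$ let $\varphi_\alpha=\eta_\alpha-c\,\xi_\alpha$ and $\varphi=\sqrt{h^{\mu\nu}\varphi_\mu\varphi_\nu}$. The *wave speeds* of the model generated by $F$ are the real $c$ for which the system $$\sum_{n=0}^N\varphi_\alpha A^{\alpha\alpha_1\cdots\alpha_m\beta_1\cdots\beta_n}\,\delta\lambda_{\beta_1\cdots\beta_n}=0\qquad(m=0,\dots,N)$$ has a nonzero solution consisting of symmetric trace-less tensors $\delta\lambda_{\beta_1\cdots\beta_n}$, $0\le n\le N$. For $0\le p\le N$, a real matrix $G=(G_{m,n})_{0\le m,n\le N}$ and scalar unknowns $X_{(h,k)}$, $h+k\le N-p$, the *characteristic system* of index $p$ is $$\sum_{n=p}^N G_{m,n}Y_{b,n}=0\qquad(b=0,\dots,N-p,\ m=p+b,\dots,N),$$ where $$\begin{aligned}Y_{b,n}={}&-\varphi_\mu u^\mu\sum_{r=[\frac{2p+b+1}2]}^{[\frac{p+b+n}2]}\ \sum_{s=p}^{[\frac{2r-b}2]}\ \sum_{T=0}^{s-p}\frac{4\pi}{2r+1}\binom{p+b+n}{2r}(-1)^{p+b+n}\binom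 rs\frac{(2r-2s)!}{(2r-2s-b)!}\frac{n!}{(p+b+n)!}\frac{(2s)!!}{(2s-2p)!!}\binom{s-p}T(-1)^T X_{(n-p-2r+b+2s-2T,\;2r-b-2s+2T)}\\&+\varphi\sum_{r=[\frac{2p+b+2}2]}^{[\frac{p+b+n+1}2]}\ \sum_{s=p}^{[\frac{2r-b-1}2]}\ \sum_{T=0}^{s-p}\frac{4\pi}{2r+1}\binom{p+b+n+1}{2r}(-1)^{p+b+n+1}\binom rs\frac{(2r-2s)!}{(2r-2s-b-1)!}\frac{n!}{(p+b+n+1)!}\frac{(2s)!!}{(2s-2p)!!}\binom{s-p}T(-1)^T X_{(n-p-2r+b+2s-2T+1,\;2r-b-2s+2T-1)}.\end{aligned}$$ Its *eigenvalues* are the real $c$ for which it has a nonzero solution. For $0\le e\le N-p$, the *block* of index $(p,e)$ is the system $Y_{q,p+e}=0$, $q=0,\dots,e$, in the unknowns $X_{(h,k)}$ with $h+k=e$; its eigenvalues are defined in the same way. For a function $F$ the coefficients are $G_{m,n}=\int_0^\infty F_{m,n}(\lambda,\rho\gamma,0,\dots,0)\,\rho^{m+n+2}\,d\rho$. The kinetic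 model is the case $F=e^{-\sum_{i=0}^N X_i/K}$ with $K>0$. Then: 1. For every $0\le p\le N$ and every matrix $G$ such that the matrices $(G_{m,n})_{m,n=p+e,\dots,N}$, $0\le e\le N-p$, are nonsingular, the set of eigenvalues of the characteristic system of index $p$ is the union over $e=0,\dots,N-p$ of the sets of eigenvalues of the blocks of index $(p,e)$. In particular it does not depend on $G$. 2. For the kinetic model, the matrix $(G_{m,n})_{m,n=0,\dots,N}$ is positive definite, and $(G_{m,n})_{m,n=j,\dots,N}$ is nonsingular for every $0\le j\le N$. 3. Let $F$ be twice continuously differentiable near the points $(\lambda,x,0,\dots,0)$, $x>0$, let the integrals defining $G_{m,n}$ converge absolutely, and assume the first condition of hyperbolicity in the direction $u$: the system $\sum_n u_\alpha A^{\alpha\alpha_1\cdots\alpha_m\beta_1\cdots\beta_n}\delta\lambda_{\beta_1\cdots\beta_n}=0$, $m=0,\dots,N$, has only the zero solution among symmetric trace-less tensors. Then $(G_{m,n})_{m,n=j,\dots,N}$ is nonsingular for every $0\le j\le N$; for every $0\le p\le N$ the characteristic system of index $p$ has the same eigenvalues for $F$ as for the kinetic model; and the wave speeds of the model generated by $F$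 coincide with those of the kinetic model. -/

import Mathlib

open scoped Nat BigOperators

noncomputable section

namespace UltraRel

/-- The diagonal entries of the Minkowski metric, of signature `(-,+,+,+)`. -/
def metric (μ : Fin 4) : ℝ := if μ = 0 then -1 else 1

/-- The Minkowski product of two (co)vectors. -/
def mink (a b : Fin 4 → ℝ) : ℝ := ∑ μ, metric μ * a μ * b μ

/-- A family of covariant tensors on space-time, one of each rank, given by components. -/
abbrev TensorFamily : Type := (n : ℕ) → (Fin n → Fin 4) → ℝ

/-- `T` is a symmetric tensor. -/
def IsSymm {n : ℕ} (T : (Fin n → Fin 4) → ℝ) : Prop :=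
  ∀ (σ : Equiv.Perm (Fin n)) (β : Fin n → Fin 4), T (β ∘ σ) = T β

/-- All traces of `T` with respect to the Minkowski metric vanish. -/
def IsTraceless {n : ℕ} (T : (Fin n → Fin 4) → ℝ) : Prop :=
  ∀ i j : Fin n, i ≠ j → ∀ β : Fin n → Fin 4,
    ∑ μ, metric μ * T (Function.update (Function.update β i μ) j μ) = 0

/-- The four-momentum `(|p|, p)` of a massless particle with momentum `p`. -/
def fourMomentum (p : EuclideanSpace ℝ (Fin 3)) : Fin 4 → ℝ :=
  Fin.cons ‖p‖ (fun i => p i)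

/-- The full contraction of a tensor with `n` copies of the vector `v`. -/
def contract {n : ℕ} (T : (Fin n → Fin 4) → ℝ) (v : Fin 4 → ℝ) : ℝ :=
  ∑ β : Fin n → Fin 4, T β * ∏ i, v (β i)

/-- The second partial derivative `F_{m,n} = ∂²F / ∂X_m ∂X_n`. -/
def secondPartial {N : ℕ} (F : (Fin (N + 1) → ℝ) → ℝ) (m n : Fin (N + 1))
    (x : Fin (N + 1) → ℝ) : ℝ :=
  fderiv ℝ (fun y => fderiv ℝ F y (Pi.single n 1)) x (Pi.single m 1)

/-- The tensor `A^{α α₁ ⋯ α_m β₁ ⋯ β_n}` of the field equations, at the Lagrange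
multipliers `Λ`; the integration is with respect to `dP = dp¹ dp² dp³ / p⁰`. -/
def fluxTensor {N : ℕ} (F : (Fin (N + 1) → ℝ) → ℝ) (Λ : TensorFamily) (m n : Fin (N + 1))
    (α : Fin 4) (a : Fin m.val → Fin 4) (b : Fin n.val → Fin 4) : ℝ :=
  ∫ p : EuclideanSpace ℝ (Fin 3),
    secondPartial F m n (fun i => contract (Λ i.val) (fourMomentum p))
      * fourMomentum p α * (∏ i, fourMomentum p (a i)) * (∏ i, fourMomentum p (b i))
      / fourMomentum p 0

/-- `δ` consists of symmetric trace-less tensors `δλ_{β₁⋯β_n}`, `n = 0, …, N`, which solve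
`ϕ_α A^{α α₁ ⋯ α_m β₁ ⋯ β_n} δλ_{β₁ ⋯ β_n} = 0` (summed over `n`) for `m = 0, …, N`. -/
def SolvesCharSystem {N : ℕ} (F : (Fin (N + 1) → ℝ) → ℝ) (Λ : TensorFamily)
    (ϕ : Fin 4 → ℝ) (δ : TensorFamily) : Prop :=
  (∀ n, n ≤ N → IsSymm (δ n) ∧ IsTraceless (δ n)) ∧
  ∀ (m : Fin (N + 1)) (a : Fin m.val → Fin 4),
    ∑ n : Fin (N + 1), ∑ b : Fin n.val → Fin 4, ∑ α : Fin 4,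
      ϕ α * fluxTensor F Λ m n α a b * δ n.val b = 0

/-- First condition of hyperbolicity in the direction `ξ`: the system
`ξ_α A^{α α₁ ⋯ α_m β₁ ⋯ β_n} δλ_{β₁ ⋯ β_n} = 0` has only the zero solution. -/
def HyperbolicityCondOne {N : ℕ} (F : (Fin (N + 1) → ℝ) → ℝ) (Λ : TensorFamily)
    (ξ : Fin 4 → ℝ) : Prop :=
  ∀ δ : TensorFamily, SolvesCharSystem F Λ ξ δ → ∀ n, n ≤ N → δ n = 0

/-- The covector `ϕ_α = η_α - c ξ_α`. -/
def phiCov (ξ η : Fin 4 → ℝ) (c : ℝ) : Fin 4 → ℝ := fun α => η α - c * ξ α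

/-- The wave speeds: the eigenvalues `c` of the system
`(η_α - c ξ_α) A^{α α₁ ⋯ α_m β₁ ⋯ β_n} δλ_{β₁ ⋯ β_n} = 0`. -/
def waveSpeeds {N : ℕ} (F : (Fin (N + 1) → ℝ) → ℝ) (Λ : TensorFamily)
    (ξ η : Fin 4 → ℝ) : Set ℝ :=
  {c | ∃ δ : TensorFamily, (∃ n, n ≤ N ∧ δ n ≠ 0) ∧ SolvesCharSystem F Λ (phiCov ξ η c) δ}

/-- The multipliers `(lam, l_μ, 0, …, 0)`. -/
def equilibrium (lam : ℝ) (l : Fin 4 → ℝ) : TensorFamily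
  | 0, _ => lam
  | 1, β => l (β 0)
  | _ + 2, _ => 0

/-- `γ = √(-l_μ l^μ)`. -/
def gam (l : Fin 4 → ℝ) : ℝ := Real.sqrt (-mink l l)

/-- `u_α = γ⁻¹ l_α`. -/
def velocity (l : Fin 4 → ℝ) : Fin 4 → ℝ := fun α => (gam l)⁻¹ * l α

/-- The point `(lam, x, 0, …, 0)` of the domain of `F`. -/
def rayPoint (N : ℕ) (lam x : ℝ) : Fin (N + 1) → ℝ :=
  fun i => if i.val = 0 then lam else if i.val = 1 then x else 0

/-- The coefficients `G_{m,n} = ∫₀^∞ F_{m,n}(lam, ρ γ) ρ^{m+n+2} dρ`. -/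
def coeffG {N : ℕ} (F : (Fin (N + 1) → ℝ) → ℝ) (lam : ℝ) (l : Fin 4 → ℝ) :
    Matrix (Fin (N + 1)) (Fin (N + 1)) ℝ :=
  fun m n => ∫ ρ in Set.Ioi (0 : ℝ),
    secondPartial F m n (rayPoint N lam (ρ * gam l)) * ρ ^ (m.val + n.val + 2)

/-- The generating function `exp(-∑ X_i / K)` of the kinetic model. -/
def kineticF (N : ℕ) (K : ℝ) : (Fin (N + 1) → ℝ) → ℝ :=
  fun X => Real.exp (-(∑ i, X i) / K)

/-- The linear combination `Y_{b,n}` of the unknowns `X_{(h,k)}` (`h + k = n - p`), with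
`w = ϕ_μ u^μ` and `f = ϕ`; it occurs in the equations with indices `m`, `b` and
`a = m - p - b`. In the ranges of summation no subtraction of naturals is truncated. -/
def coeffY (p b n : ℕ) (w f : ℝ) (X : ℕ → ℕ → ℝ) : ℝ :=
  -w * (∑ r ∈ Finset.Icc ((2 * p + b + 1) / 2) ((p + b + n) / 2),
      ∑ s ∈ Finset.Icc p ((2 * r - b) / 2), ∑ T ∈ Finset.range (s - p + 1),
        4 * Real.pi / (2 * (r : ℝ) + 1) * ((p + b + n).choose (2 * r) : ℝ)
          * (-1) ^ (p + b + n) * (r.choose s : ℝ)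
          * (((2 * r - 2 * s)! : ℝ) / ((2 * r - 2 * s - b)! : ℝ))
          * ((n ! : ℝ) / ((p + b + n)! : ℝ))
          * (((2 * s)‼ : ℝ) / ((2 * s - 2 * p)‼ : ℝ))
          * ((s - p).choose T : ℝ) * (-1) ^ T
          * X (n + b + 2 * s - (p + 2 * r + 2 * T)) (2 * r + 2 * T - (b + 2 * s)))
  + f * (∑ r ∈ Finset.Icc ((2 * p + b + 2) / 2) ((p + b + n + 1) / 2),
      ∑ s ∈ Finset.Icc p ((2 * r - b - 1) / 2), ∑ T ∈ Finset.range (s - p + 1),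
        4 * Real.pi / (2 * (r : ℝ) + 1) * ((p + b + n + 1).choose (2 * r) : ℝ)
          * (-1) ^ (p + b + n + 1) * (r.choose s : ℝ)
          * (((2 * r - 2 * s)! : ℝ) / ((2 * r - 2 * s - b - 1)! : ℝ))
          * ((n ! : ℝ) / ((p + b + n + 1)! : ℝ))
          * (((2 * s)‼ : ℝ) / ((2 * s - 2 * p)‼ : ℝ))
          * ((s - p).choose T : ℝ) * (-1) ^ T
          * X (n + b + 2 * s + 1 - (p + 2 * r + 2 * T)) (2 * r + 2 * T - (b + 2 * s + 1)))

/-- The scalar matrix of the system `∑_{n=p}^N G_{m,n} Y_{b,n} = 0` (`b = 0, …, N - p`,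
`m = p + b, …, N`) in the unknowns `X_{(h,k)}`, `h + k ≤ N - p`, is singular. -/
def CharSingular {N : ℕ} (p : ℕ) (G : Matrix (Fin (N + 1)) (Fin (N + 1)) ℝ) (w f : ℝ) : Prop :=
  ∃ X : ℕ → ℕ → ℝ, (∃ h k, p + h + k ≤ N ∧ X h k ≠ 0) ∧
    ∀ (b : ℕ) (m : Fin (N + 1)), p + b ≤ m.val →
      ∑ n : Fin (N + 1) with p ≤ n.val, G m n * coeffY p b n.val w f X = 0

/-- The scalar matrix of the system `Y_{q,p+e} = 0` (`q = 0, …, e`) in the unknowns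
`X_{(h,k)}`, `h + k = e`, is singular. -/
def BlockSingular (p e : ℕ) (w f : ℝ) : Prop :=
  ∃ X : ℕ → ℕ → ℝ, (∃ h k, h + k = e ∧ X h k ≠ 0) ∧
    ∀ q, q ≤ e → coeffY p q (p + e) w f X = 0

/-- `ϕ_μ u^μ` for the covector `ϕ_μ`. -/
def timePart (u ϕ : Fin 4 → ℝ) : ℝ := mink ϕ u

/-- `ϕ = √(h^{μν} ϕ_μ ϕ_ν)`, with `h_{αβ} = g_{αβ} + u_α u_β`. -/
def spacePart (u ϕ : Fin 4 → ℝ) : ℝ := Real.sqrt (mink ϕ ϕ + mink ϕ u ^ 2)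

/-- The eigenvalues of the characteristic system with index `p` and coefficients `G`. -/
def charEigenvalues {N : ℕ} (p : ℕ) (G : Matrix (Fin (N + 1)) (Fin (N + 1)) ℝ)
    (u ξ η : Fin 4 → ℝ) : Set ℝ :=
  {c | CharSingular p G (timePart u (phiCov ξ η c)) (spacePart u (phiCov ξ η c))}

/-- The eigenvalues of the block `Y_{q,p+e} = 0`, `q = 0, …, e`. -/
def blockEigenvalues (p e : ℕ) (u ξ η : Fin 4 → ℝ) : Set ℝ :=
  {c | BlockSingular p e (timePart u (phiCov ξ η c)) (spacePart u (phiCov ξ η c))}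

/-- The matrix `(G_{m,n})` with `m, n = j, …, N` is nonsingular. -/
def TrailingNonsingular {N : ℕ} (G : Matrix (Fin (N + 1)) (Fin (N + 1)) ℝ) (j : ℕ) : Prop :=
  (Matrix.toSquareBlockProp G (fun i : Fin (N + 1) => j ≤ i.val)).det ≠ 0

end UltraRel

end

/-!
The proof rests on separating the radial and the angular integrations. At equilibrium the
multipliers only enter through `l_α p^α`, so polar coordinates `p = r ω` and the substitution
`ρ = r u_α (1, ω)^α` give (`fluxTensor_equilibrium`)

  `A^{α α₁ ⋯ α_m β₁ ⋯ β_n} = G_{m,n} ∫ q^α q^{α₁} ⋯ q^{α_m} q^{β₁} ⋯ q^{β_n} dν`,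

where `q` runs over the null vectors with `u_α q^α = 1` and `ν` is a finite measure that does not
depend on `F`. Let `P ^ n` be the space of polynomials of degree `n` in `q`. Since `u_α q^α = 1`,
these spaces increase, and they do so strictly because the functions `q^α` are not all integral over
`ℝ` (`not_coneSpan_pow_succ_le`). Every element of `P ^ n` is `T(q, …, q)` for a symmetric trace-less `T`
(`exists_tracelessSymm_tensorFn_eq`), and under the first condition of hyperbolicity `T` is unique,
since a tensor vanishing on the cone solves the equations in all directions
(`tensorFn_injOn_of_hyperbolicity`). The system therefore reads

  `∑ₙ G_{m,n} ∫ ϕ(q) δ_n(q) ψ(q) dν = 0` for all `ψ ∈ P ^ m` and all `m`.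

The eigenvalues of such a system do not depend on `G` when the trailing blocks of `G` are
nonsingular (`exists_solution_iff_exists_block_solution`). Testing the equations `m ≥ e` with
`ψ ∈ P ^ e` and inverting the trailing block eliminates `G` once the unknowns with `n < e` vanish, so
the system is triangular with respect to the degree; a dimension count (the unknowns of index `n` are
as many as the tests of degree `n`) shows that it is singular exactly when one of the systems
`∫ ϕ(q) δ_n(q) ψ(q) dν = 0`, `ψ ∈ P ^ n`, is. The characteristic systems of index `p` have the same
shape, with polynomials in one variable as tests (`charSingular_iff`).

The trailing blocks of `G` are nonsingular for the kinetic model because `G` is the Gram matrix of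
the monomials for a positive weight (`posDef_coeffG_kineticF`). For a hyperbolic model, a vector `v`
in the kernel of the trailing block of index `j` and an `h ∈ P ^ j` orthogonal to the smaller degrees
would produce the nonzero solution `δ_n = v_n h` of the system along `u`
(`trailingNonsingular_of_hyperbolicity`).
-/

noncomputable section

namespace UltraRel

open MeasureTheory

/-! ### Block triangular systems -/

/-- A trailing block of `G` is nonsingular exactly when it kills no nonzero vector; vectors on the
trailing indices are encoded as vectors vanishing at the other indices. -/
lemma trailingNonsingular_iff {N : ℕ} {G : Matrix (Fin (N + 1)) (Fin (N + 1)) ℝ} {j : ℕ} :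
    TrailingNonsingular G j ↔ ∀ x : Fin (N + 1) → ℝ, (∀ n, n.val < j → x n = 0) →
      (∀ m : Fin (N + 1), j ≤ m.val → ∑ n, G m n * x n = 0) → x = 0 := by
  have key : ∀ (x : Fin (N + 1) → ℝ), (∀ n, n.val < j → x n = 0) → ∀ m : Fin (N + 1),
      ∑ n, G m n * x n = ∑ n : {i : Fin (N + 1) // j ≤ i.val}, G m n * x n := by
    intro x hx m
    rw [← Finset.sum_subtype (Finset.univ.filter fun i : Fin (N + 1) => j ≤ i.val) (by simp)
      (fun n => G m n * x n), Finset.sum_filter]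
    refine Finset.sum_congr rfl fun n _ => ?_
    split_ifs with h
    · rfl
    · rw [hx n (not_le.1 h), mul_zero]
  unfold TrailingNonsingular
  rw [Ne, ← Matrix.exists_mulVec_eq_zero_iff]
  constructor
  · intro h x hx hG
    by_contra hne
    refine h ⟨fun n => x n, ?_, ?_⟩
    · intro h0
      refine hne (funext fun n => ?_)
      by_cases hn : j ≤ n.val
      · exact congrFun h0 ⟨n, hn⟩
      · exact hx n (not_le.1 hn)
    · funext m
      have := hG m m.2
      rw [key x hx] at this
      simpa [Matrix.mulVec, dotProduct, Matrix.toSquareBlockProp] using this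
  · rintro h ⟨v, hv, hGv⟩
    set x : Fin (N + 1) → ℝ := fun n => if hn : j ≤ n.val then v ⟨n, hn⟩ else 0 with hxdef
    have hx : ∀ n, n.val < j → x n = 0 := fun n hn => by simp [hxdef, not_le.2 hn]
    have hx' : ∀ n : {i : Fin (N + 1) // j ≤ i.val}, x n = v n := fun n => by
      simp only [hxdef, n.2, dif_pos]
    have h0 := h x hx fun m hm => by
      rw [key x hx]
      have := congrFun hGv ⟨m, hm⟩
      simp only [hx']
      simpa [Matrix.mulVec, dotProduct, Matrix.toSquareBlockProp] using this
    exact hv (funext fun n => by rw [← hx' n, h0]; rfl)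

section BlockTriangular

variable {N p : ℕ} {G : Matrix (Fin (N + 1)) (Fin (N + 1)) ℝ} {V : Type*} [AddCommGroup V]
  [Module ℝ V] {P : Fin (N + 1) → Submodule ℝ V} {U : Fin (N + 1) → Type*}
  [∀ n, AddCommGroup (U n)] [∀ n, Module ℝ (U n)]

/-- The elimination step: if the functionals `y n` vanish for `n < e`, then testing the equations
`m ≥ e` with `v ∈ P e ⊆ P m` and inverting the trailing block of `G` gives `y e v = 0`. -/
lemma apply_eq_zero_of_trailing
    (hG : ∀ j, p ≤ j → j ≤ N → TrailingNonsingular G j) (hP : Monotone P)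
    (hP0 : ∀ n : Fin (N + 1), n.val < p → P n = ⊥) (y : Fin (N + 1) → V →ₗ[ℝ] ℝ)
    (hy : ∀ m, ∀ v ∈ P m, ∑ n, G m n * y n v = 0) (e : Fin (N + 1))
    (he : ∀ n < e, y n = 0) {v : V} (hv : v ∈ P e) : y e v = 0 := by
  by_cases hp : e.val < p
  · rw [hP0 e hp, Submodule.mem_bot] at hv
    rw [hv, map_zero]
  · have := trailingNonsingular_iff.1 (hG e (not_lt.1 hp) (Nat.lt_succ_iff.1 e.2))
      (fun n => y n v) (fun n hn => by rw [he n hn]; rfl)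
      (fun m hm => hy m v (hP (Fin.le_def.2 hm) hv))
    exact congrFun this e

/-- A block triangular system is singular if and only if one of its diagonal blocks is.
The unknowns are `x n ∈ U n`, the equations with index `m` are tested with the members `P m` of an
increasing chain, and `U n` has the dimension of `P n`. -/
theorem exists_solution_iff_exists_block_solution [∀ n, FiniteDimensional ℝ (P n)]
    [∀ n, FiniteDimensional ℝ (U n)]
    (hG : ∀ j, p ≤ j → j ≤ N → TrailingNonsingular G j) (hP : Monotone P)
    (hP0 : ∀ n : Fin (N + 1), n.val < p → P n = ⊥)
    (hU : ∀ n, Module.finrank ℝ (U n) = Module.finrank ℝ (P n))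
    (Y : ∀ n, U n →ₗ[ℝ] V →ₗ[ℝ] ℝ) :
    (∃ x : ∀ n, U n, x ≠ 0 ∧ ∀ m, ∀ v ∈ P m, ∑ n, G m n * Y n (x n) v = 0) ↔
      ∃ n, ∃ x : U n, x ≠ 0 ∧ ∀ v ∈ P n, Y n x v = 0 := by
  rw [← not_iff_not]
  push Not
  constructor
  · intro hinj
    let L : (∀ n, U n) →ₗ[ℝ] (∀ m, Module.Dual ℝ (P m)) :=
      LinearMap.pi fun m => ∑ n, G m n •
        ((LinearMap.lcomp ℝ ℝ (P m).subtype).comp (Y n)).comp (LinearMap.proj n)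
    have hL : ∀ x m (v : P m), L x m v = ∑ n, G m n * Y n (x n) v := by
      intro x m v
      simp [L, LinearMap.sum_apply]
    have hLinj : Function.Injective L := by
      rw [injective_iff_map_eq_zero]
      intro x hx
      by_contra hne
      obtain ⟨m, v, hv, h⟩ := hinj x hne
      exact h (by rw [← hL x m ⟨v, hv⟩, hx]; rfl)
    have hLsurj : Function.Surjective L :=
      (LinearMap.injective_iff_surjective_of_finrank_eq_finrank
        (by simp [Module.finrank_pi_fintype, Subspace.dual_finrank_eq, hU])).1 hLinj
    intro e
    induction e using WellFoundedLT.induction with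
    | _ e ih =>
    let B : U e →ₗ[ℝ] Module.Dual ℝ (P e) := (LinearMap.lcomp ℝ ℝ (P e).subtype).comp (Y e)
    -- A preimage under `L` of the data concentrated at `n = e` vanishes below `e`.
    have hBsurj : Function.Surjective B := by
      intro g
      obtain ⟨g', hg'⟩ := LinearMap.exists_extend g
      obtain ⟨x, hx⟩ := hLsurj fun m => G m e • g' ∘ₗ (P m).subtype
      have hy : ∀ m, ∀ v ∈ P m,
          ∑ n, G m n * (Y n (x n) - (if n = e then g' else 0)) v = 0 := by
        intro m v hv
        have := congrArg (fun z => z m ⟨v, hv⟩) hx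
        simp only [hL] at this
        simp only [LinearMap.sub_apply, mul_sub, Finset.sum_sub_distrib, this]
        rw [Finset.sum_eq_single e (fun n _ hn => by simp [hn]) (by simp)]
        simp
      have hlow : ∀ n < e, x n = 0 := by
        intro n
        induction n using WellFoundedLT.induction with
        | _ n ihn =>
        intro hn
        by_contra hne
        obtain ⟨v, hv, h⟩ := ih n hn (x n) hne
        have := apply_eq_zero_of_trailing hG hP hP0 _ hy n
          (fun k hk => by simp [ihn k hk (hk.trans hn), (hk.trans hn).ne]) hv
        simp [hn.ne, h] at this
      refine ⟨x e, LinearMap.ext fun v => ?_⟩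
      have := apply_eq_zero_of_trailing hG hP hP0 _ hy e
        (fun k hk => by simp [hlow k hk, hk.ne]) v.2
      simp only [if_true, LinearMap.sub_apply, sub_eq_zero] at this
      rw [← hg']
      exact this
    have hBinj := (LinearMap.injective_iff_surjective_of_finrank_eq_finrank
      (by simp [Subspace.dual_finrank_eq, hU])).2 hBsurj
    intro x hx
    by_contra! h
    exact hx (hBinj (by rw [map_zero]; exact LinearMap.ext fun v => h v v.2))
  · intro hblock x hx
    by_contra! h
    refine hx (funext fun e => ?_)
    induction e using WellFoundedLT.induction with
    | _ e ih =>
    by_contra hne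
    obtain ⟨v, hv, hv'⟩ := hblock e (x e) hne
    exact hv' (apply_eq_zero_of_trailing hG hP hP0 (fun n => Y n (x n)) h e
      (fun n hn => by simp [ih n hn]) hv)

end BlockTriangular

/-! ### The characteristic system and its blocks -/

lemma coeffY_add (p b n : ℕ) (w f : ℝ) (X X' : ℕ → ℕ → ℝ) :
    coeffY p b n w f (X + X') = coeffY p b n w f X + coeffY p b n w f X' := by
  simp only [coeffY, Pi.add_apply, mul_add, Finset.sum_add_distrib]
  ring

lemma coeffY_smul (p b n : ℕ) (w f c : ℝ) (X : ℕ → ℕ → ℝ) :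
    coeffY p b n w f (c • X) = c * coeffY p b n w f X := by
  simp only [coeffY, Pi.smul_apply, smul_eq_mul, mul_add, Finset.mul_sum]
  congr 1 <;> refine Finset.sum_congr rfl fun r _ => Finset.sum_congr rfl fun s _ =>
    Finset.sum_congr rfl fun T _ => by ring

/-- `Y_{b,n}` only involves the unknowns `X_{(h,k)}` with `h + k = n - p`. -/
lemma coeffY_congr {p b n : ℕ} (hpn : p ≤ n) (w f : ℝ) {X X' : ℕ → ℕ → ℝ}
    (h : ∀ i k, p + i + k = n → X i k = X' i k) :
    coeffY p b n w f X = coeffY p b n w f X' := by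
  unfold coeffY
  congr 2
  · refine Finset.sum_congr rfl fun r hr => Finset.sum_congr rfl fun s hs =>
      Finset.sum_congr rfl fun T hT => ?_
    rw [Finset.mem_Icc] at hr hs
    rw [Finset.mem_range] at hT
    rw [h _ _ (by omega)]
  · refine Finset.sum_congr rfl fun r hr => Finset.sum_congr rfl fun s hs =>
      Finset.sum_congr rfl fun T hT => ?_
    rw [Finset.mem_Icc] at hr hs
    rw [Finset.mem_range] at hT
    rw [h _ _ (by omega)]

/-- The unknowns `X_{(h,k)}`, `h + k = n - p`, extended by zero, from their list indexed by `k`. -/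
def unknowns (p n : ℕ) (x : Fin (n + 1 - p) → ℝ) : ℕ → ℕ → ℝ :=
  fun h k => if hk : k < n + 1 - p ∧ p + h + k = n then x ⟨k, hk.1⟩ else 0

lemma unknowns_add (p n : ℕ) (x y : Fin (n + 1 - p) → ℝ) :
    unknowns p n (x + y) = unknowns p n x + unknowns p n y := by
  funext h k
  by_cases hk : k < n + 1 - p ∧ p + h + k = n <;> simp [unknowns, hk]

lemma unknowns_smul (p n : ℕ) (c : ℝ) (x : Fin (n + 1 - p) → ℝ) :
    unknowns p n (c • x) = c • unknowns p n x := by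
  funext h k
  by_cases hk : k < n + 1 - p ∧ p + h + k = n <;> simp [unknowns, hk]

lemma unknowns_restrict {p n : ℕ} (X : ℕ → ℕ → ℝ) {h k : ℕ} (hk : p + h + k = n) :
    unknowns p n (fun k => X (n - p - k) k) h k = X h k := by
  have : n - p - k = h := by omega
  rw [unknowns, dif_pos ⟨by omega, hk⟩, this]

/-- The pairing of the unknowns `X_{(h,k)}`, `h + k = n - p`, with a test polynomial; against the
monomial of degree `b` it is `Y_{b,n}`. -/
def coeffYPairing (N p : ℕ) (w f : ℝ) (n : Fin (N + 1)) :
    (Fin (n.val + 1 - p) → ℝ) →ₗ[ℝ] Polynomial ℝ →ₗ[ℝ] ℝ :=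
  LinearMap.mk₂ ℝ
    (fun x v => ∑ b ∈ Finset.range (N + 1), v.coeff b * coeffY p b n w f (unknowns p n x))
    (fun x y v => by simp only [unknowns_add, coeffY_add, mul_add, Finset.sum_add_distrib])
    (fun c x v => by
      simp only [unknowns_smul, coeffY_smul, smul_eq_mul, Finset.mul_sum, mul_left_comm c])
    (fun x v v' => by simp only [Polynomial.coeff_add, add_mul, Finset.sum_add_distrib])
    (fun c x v => by
      simp only [Polynomial.coeff_smul, smul_eq_mul, Finset.mul_sum, mul_assoc])

lemma coeffYPairing_apply {N p : ℕ} {w f : ℝ} {n : Fin (N + 1)} (x : Fin (n.val + 1 - p) → ℝ)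
    (v : Polynomial ℝ) : coeffYPairing N p w f n x v =
      ∑ b ∈ Finset.range (N + 1), v.coeff b * coeffY p b n w f (unknowns p n x) := rfl

lemma coeffYPairing_monomial {N p : ℕ} {w f : ℝ} {n : Fin (N + 1)} (x : Fin (n.val + 1 - p) → ℝ)
    {b : ℕ} (hb : b ≤ N) : coeffYPairing N p w f n x (Polynomial.X ^ b) =
      coeffY p b n w f (unknowns p n x) := by
  rw [coeffYPairing_apply, Finset.sum_eq_single b]
  · simp
  · intro c _ hc
    simp [Polynomial.coeff_X_pow, hc]
  · intro h
    simp only [Finset.mem_range] at h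
    omega

lemma coeff_eq_zero_of_mem_degreeLT {m b : ℕ} {v : Polynomial ℝ}
    (hv : v ∈ Polynomial.degreeLT ℝ m) (hb : m ≤ b) : v.coeff b = 0 :=
  Polynomial.coeff_eq_zero_of_degree_lt
    ((Polynomial.mem_degreeLT.1 hv).trans_le (by exact_mod_cast hb))

lemma charSingular_iff_exists_pairing {N p : ℕ} {G : Matrix (Fin (N + 1)) (Fin (N + 1)) ℝ}
    {w f : ℝ} : CharSingular p G w f ↔
      ∃ x : ∀ n : Fin (N + 1), Fin (n.val + 1 - p) → ℝ, x ≠ 0 ∧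
        ∀ m : Fin (N + 1), ∀ v ∈ Polynomial.degreeLT ℝ (m.val + 1 - p),
          ∑ n, G m n * coeffYPairing N p w f n (x n) v = 0 := by
  -- For `n < p` there are no unknowns, so the sums over `n` and over `n ≥ p` agree.
  have hsum : ∀ (x : ∀ n : Fin (N + 1), Fin (n.val + 1 - p) → ℝ) (m : Fin (N + 1)) (b : ℕ),
      b ≤ N → ∑ n, G m n * coeffYPairing N p w f n (x n) (Polynomial.X ^ b) =
        ∑ n : Fin (N + 1) with p ≤ n.val, G m n * coeffY p b n w f (unknowns p n (x n)) := by
    intro x m b hb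
    rw [Finset.sum_filter]
    refine Finset.sum_congr rfl fun n _ => ?_
    split_ifs with hn
    · rw [coeffYPairing_monomial _ hb]
    · have : x n = 0 := funext fun k => absurd k.2 (by omega)
      simp [this]
  constructor
  · rintro ⟨X, ⟨h, k, hhk, hX⟩, hsys⟩
    refine ⟨fun n k => X (n - p - k) k, fun h0 => hX ?_, fun m v hv => ?_⟩
    · have := congrFun (congrFun h0 ⟨p + h + k, by omega⟩) ⟨k, by simp only; omega⟩
      simp only [Pi.zero_apply] at this
      rwa [show p + h + k - p - k = h by omega] at this
    · have hv' : v = ∑ b ∈ Finset.range (m.val + 1 - p), v.coeff b • Polynomial.X ^ b := by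
        ext i
        simp only [Polynomial.finsetSum_coeff, Polynomial.coeff_smul, Polynomial.coeff_X_pow,
          smul_eq_mul, mul_ite, mul_one, mul_zero, Finset.sum_ite_eq, Finset.mem_range]
        split_ifs with hi
        · rfl
        · exact coeff_eq_zero_of_mem_degreeLT hv (not_lt.1 hi)
      rw [hv']
      simp only [map_sum, map_smul, Finset.mul_sum, smul_eq_mul, mul_left_comm (G m _)]
      rw [Finset.sum_comm]
      refine Finset.sum_eq_zero fun b hb => ?_
      have hb' := Finset.mem_range.1 hb
      rw [← Finset.mul_sum, hsum (fun n k => X (n - p - k) k) m b (by omega)]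
      have := hsys b m (by omega)
      rw [Finset.sum_congr rfl fun n hn => ?_, this, mul_zero]
      rw [coeffY_congr (Finset.mem_filter.1 hn).2 w f fun i k hik => unknowns_restrict X hik]
  · rintro ⟨x, hx, hsys⟩
    obtain ⟨n, hn⟩ := Function.ne_iff.1 hx
    obtain ⟨k, hk⟩ := Function.ne_iff.1 hn
    obtain ⟨X, hX⟩ : ∃ X : ℕ → ℕ → ℝ, ∀ n : Fin (N + 1), ∀ i k, p + i + k = n.val →
        unknowns p n (x n) i k = X i k := by
      refine ⟨fun h k => if hhk : p + h + k ≤ N then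
        unknowns p (p + h + k) (x ⟨p + h + k, by omega⟩) h k else 0, ?_⟩
      rintro ⟨n, hn⟩ i k hik
      simp only at hik
      subst hik
      simp only
      rw [dif_pos (by omega)]
    refine ⟨X, ⟨n.val - p - k, k, by omega, ?_⟩, fun b m hbm => ?_⟩
    · rw [← hX n _ _ (by omega), unknowns, dif_pos ⟨k.2, by omega⟩]
      exact hk
    · rw [Finset.sum_congr rfl fun n hn => by
        rw [coeffY_congr (Finset.mem_filter.1 hn).2 w f fun i k hik => (hX n i k hik).symm],
        ← hsum x m b (by omega)]
      exact hsys m _ (Polynomial.mem_degreeLT.2 (by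
        rw [Polynomial.degree_X_pow]; exact_mod_cast (by omega : b < m.val + 1 - p)))

lemma blockSingular_iff_exists_pairing {N p : ℕ} {w f : ℝ} (n : Fin (N + 1)) (hpn : p ≤ n.val) :
    BlockSingular p (n.val - p) w f ↔ ∃ x : Fin (n.val + 1 - p) → ℝ, x ≠ 0 ∧
      ∀ v ∈ Polynomial.degreeLT ℝ (n.val + 1 - p), coeffYPairing N p w f n x v = 0 := by
  have hn : p + (n.val - p) = n.val := by omega
  constructor
  · rintro ⟨X, ⟨h, k, hhk, hX⟩, hsys⟩
    refine ⟨fun k => X (n.val - p - k) k, fun h0 => hX ?_, fun v hv => ?_⟩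
    · have := congrFun h0 ⟨k, by omega⟩
      simp only [Pi.zero_apply] at this
      rwa [show n.val - p - k = h by omega] at this
    · rw [coeffYPairing_apply]
      refine Finset.sum_eq_zero fun b _ => ?_
      by_cases hb : b < n.val + 1 - p
      · have := hsys b (by omega)
        rw [hn] at this
        rw [coeffY_congr hpn w f fun i k hik => unknowns_restrict X hik, this, mul_zero]
      · rw [coeff_eq_zero_of_mem_degreeLT hv (not_lt.1 hb), zero_mul]
  · rintro ⟨x, hx, hsys⟩
    obtain ⟨k, hk⟩ := Function.ne_iff.1 hx
    refine ⟨unknowns p n x, ⟨n.val - p - k, k, by omega, ?_⟩, fun q hq => ?_⟩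
    · rw [unknowns, dif_pos ⟨k.2, by omega⟩]
      exact hk
    · rw [hn, ← coeffYPairing_monomial (N := N) x (by omega)]
      exact hsys _ (Polynomial.mem_degreeLT.2 (by
        rw [Polynomial.degree_X_pow]; exact_mod_cast (by omega : q < n.val + 1 - p)))

lemma finrank_degreeLT (n : ℕ) : Module.finrank ℝ (Polynomial.degreeLT ℝ n) = n := by
  rw [(Polynomial.degreeLTEquiv ℝ n).finrank_eq]
  simp

/-- The characteristic system of index `p` is singular exactly when one of its blocks is. -/
theorem charSingular_iff {N p : ℕ} {G : Matrix (Fin (N + 1)) (Fin (N + 1)) ℝ}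
    (hG : ∀ e, p + e ≤ N → TrailingNonsingular G (p + e)) (w f : ℝ) :
    CharSingular p G w f ↔ ∃ e, p + e ≤ N ∧ BlockSingular p e w f := by
  have hfin : ∀ n : Fin (N + 1), FiniteDimensional ℝ (Polynomial.degreeLT ℝ (n.val + 1 - p)) :=
    fun n => (Polynomial.degreeLTEquiv ℝ _).symm.finiteDimensional
  rw [charSingular_iff_exists_pairing, exists_solution_iff_exists_block_solution (p := p)
    (P := fun n : Fin (N + 1) => Polynomial.degreeLT ℝ (n.val + 1 - p))
    (U := fun n : Fin (N + 1) => Fin (n.val + 1 - p) → ℝ)]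
  · constructor
    · rintro ⟨n, x, hx, h⟩
      have hpn : p ≤ n.val := by
        by_contra hpn
        exact hx (funext fun k => absurd k.2 (by omega))
      exact ⟨n.val - p, by omega, (blockSingular_iff_exists_pairing n hpn).2 ⟨x, hx, h⟩⟩
    · rintro ⟨e, he, h⟩
      refine ⟨⟨p + e, by omega⟩, (blockSingular_iff_exists_pairing _ (by simp)).1 ?_⟩
      simpa using h
  · intro j hpj hj
    obtain ⟨e, rfl⟩ := Nat.exists_eq_add_of_le hpj
    exact hG e hj
  · exact fun m n hmn => Polynomial.degreeLT_mono (by have := Fin.le_def.1 hmn; omega)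
  · intro n hn
    rw [show n.val + 1 - p = 0 by omega]
    rw [eq_bot_iff]
    intro v hv
    rw [Submodule.mem_bot]
    ext i
    exact coeff_eq_zero_of_mem_degreeLT hv (Nat.zero_le i)
  · intro n
    rw [finrank_degreeLT]
    simp

theorem charEigenvalues_eq_iUnion {N p : ℕ} (hp : p ≤ N)
    {G : Matrix (Fin (N + 1)) (Fin (N + 1)) ℝ}
    (hG : ∀ e, p + e ≤ N → TrailingNonsingular G (p + e)) (u ξ η : Fin 4 → ℝ) :
    charEigenvalues p G u ξ η = ⋃ e ∈ Finset.range (N - p + 1), blockEigenvalues p e u ξ η := by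
  ext c
  simp only [charEigenvalues, blockEigenvalues, Set.mem_ofPred_eq, charSingular_iff hG,
    Set.mem_iUnion, Finset.mem_range, exists_prop]
  refine exists_congr fun e => and_congr_left fun _ => ?_
  omega

/-! ### The kinetic model -/

lemma contDiff_kineticF (N : ℕ) (K : ℝ) : ContDiff ℝ 2 (kineticF N K) := by
  unfold kineticF
  fun_prop

lemma secondPartial_kineticF (N : ℕ) (K : ℝ) (m n : Fin (N + 1)) (x : Fin (N + 1) → ℝ) :
    secondPartial (kineticF N K) m n x = (K⁻¹) ^ 2 * kineticF N K x := by
  let A : (Fin (N + 1) → ℝ) →L[ℝ] ℝ :=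
    (-K⁻¹) • ∑ i, (ContinuousLinearMap.proj i : (Fin (N + 1) → ℝ) →L[ℝ] ℝ)
  have hA : ∀ y, A y = -(∑ i, y i) / K := fun y => by
    simp [A]
    ring
  have hsingle : ∀ i : Fin (N + 1), A (Pi.single i 1) = -K⁻¹ := fun i => by
    rw [hA]
    simp [neg_div]
  have hF : kineticF N K = fun y => Real.exp (A y) := by
    funext y
    rw [hA, kineticF]
  have hfd : ∀ y, HasFDerivAt (kineticF N K) (Real.exp (A y) • A) y := fun y => by
    rw [hF]
    exact A.hasFDerivAt.exp
  have h1 : (fun y => fderiv ℝ (kineticF N K) y (Pi.single n 1)) =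
      fun y => kineticF N K y * (-K⁻¹) := by
    funext y
    rw [(hfd y).fderiv, hF]
    simp [hsingle]
  rw [secondPartial, h1, ((hfd x).mul_const (-K⁻¹)).fderiv, hF]
  simp [hsingle]
  ring

lemma sum_rayPoint {N : ℕ} (hN : 1 ≤ N) (lam x : ℝ) : ∑ i, rayPoint N lam x i = lam + x := by
  have : ∀ i : Fin (N + 1), rayPoint N lam x i =
      (if i = 0 then lam else 0) + (if i = ⟨1, by omega⟩ then x else 0) := by
    intro i
    simp only [rayPoint, Fin.ext_iff, Fin.val_zero]
    split_ifs <;> simp_all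
  simp [this, Finset.sum_add_distrib]

lemma gam_pos {l : Fin 4 → ℝ} (hl : mink l l < 0) : 0 < gam l :=
  Real.sqrt_pos.2 (by linarith)

lemma kineticF_integrand {N : ℕ} (hN : 1 ≤ N) (lam K : ℝ) (l : Fin 4 → ℝ) (m n : Fin (N + 1)) :
    (fun ρ : ℝ => secondPartial (kineticF N K) m n (rayPoint N lam (ρ * gam l))
      * ρ ^ (m.val + n.val + 2)) = fun ρ : ℝ => (K⁻¹ ^ 2 * Real.exp (-lam / K)) *
        (ρ ^ (m.val + n.val + 2) * Real.exp (-(gam l / K) * ρ)) := by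
  funext ρ
  rw [secondPartial_kineticF, kineticF, sum_rayPoint hN,
    show -(lam + ρ * gam l) / K = -lam / K + -(gam l / K) * ρ by ring, Real.exp_add]
  ring

lemma integrableOn_pow_mul_exp {b : ℝ} (hb : 0 < b) (k : ℕ) :
    IntegrableOn (fun ρ : ℝ => ρ ^ k * Real.exp (-b * ρ)) (Set.Ioi 0) := by
  have := integrableOn_rpow_mul_exp_neg_mul_rpow (p := 1) (s := k) (b := b)
    (by have := k.cast_nonneg (α := ℝ); linarith) one_pos hb
  simpa using this

lemma integrableOn_kineticF {N : ℕ} (hN : 1 ≤ N) (lam : ℝ) {K : ℝ} (hK : 0 < K) {l : Fin 4 → ℝ}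
    (hl : mink l l < 0) (m n : Fin (N + 1)) :
    IntegrableOn (fun ρ : ℝ => secondPartial (kineticF N K) m n (rayPoint N lam (ρ * gam l))
      * ρ ^ (m.val + n.val + 2)) (Set.Ioi 0) := by
  rw [kineticF_integrand hN]
  exact (integrableOn_pow_mul_exp (div_pos (gam_pos hl) hK) _).const_mul _

/-- The coefficients of the kinetic model form the Gram matrix of the monomials `ρ ^ m` for the
weight `ρ ^ 2 exp (-γ ρ / K)` on the half line. -/
theorem posDef_coeffG_kineticF {N : ℕ} (hN : 1 ≤ N) (lam : ℝ) {K : ℝ} (hK : 0 < K)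
    {l : Fin 4 → ℝ} (hl : mink l l < 0) : (coeffG (kineticF N K) lam l).PosDef := by
  set b := gam l / K with hb
  have hbpos : 0 < b := div_pos (gam_pos hl) hK
  set C := K⁻¹ ^ 2 * Real.exp (-lam / K) with hC
  have hCpos : 0 < C := by positivity
  have hG : ∀ m n : Fin (N + 1), coeffG (kineticF N K) lam l m n =
      ∫ ρ in Set.Ioi (0 : ℝ), C * (ρ ^ (m.val + n.val + 2) * Real.exp (-b * ρ)) := by
    intro m n
    rw [coeffG, kineticF_integrand hN]
  refine Matrix.PosDef.of_dotProduct_mulVec_pos ?_ fun x hx => ?_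
  · ext m n
    simp [hG, add_comm n.val m.val]
  let P : Polynomial ℝ := ∑ i : Fin (N + 1), Polynomial.C (x i) * Polynomial.X ^ i.val
  have hP0 : P ≠ 0 := by
    intro h0
    refine hx (funext fun i => ?_)
    have := congrArg (fun q => q.coeff i.val) h0
    simpa [P, Polynomial.finsetSum_coeff, Polynomial.coeff_C_mul, Polynomial.coeff_X_pow,
      Fin.val_inj] using this
  have hP : ∀ ρ, P.eval ρ = ∑ i : Fin (N + 1), x i * ρ ^ i.val := fun ρ => by
    simp [P, Polynomial.eval_finsetSum]
  have hterm : ∀ m n : Fin (N + 1), IntegrableOn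
      (fun ρ : ℝ => x m * x n * (C * (ρ ^ (m.val + n.val + 2) * Real.exp (-b * ρ))))
      (Set.Ioi 0) := fun m n =>
    ((integrableOn_pow_mul_exp hbpos _).const_mul C).const_mul _
  have hsq : ∀ ρ : ℝ, ∑ m : Fin (N + 1), ∑ n : Fin (N + 1),
      x m * x n * (C * (ρ ^ (m.val + n.val + 2) * Real.exp (-b * ρ))) =
        C * (P.eval ρ ^ 2 * ρ ^ 2 * Real.exp (-b * ρ)) := by
    intro ρ
    rw [hP, sq (∑ i : Fin (N + 1), x i * ρ ^ i.val), Finset.sum_mul_sum]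
    simp only [Finset.sum_mul, Finset.mul_sum]
    refine Finset.sum_congr rfl fun m _ => Finset.sum_congr rfl fun n _ => ?_
    ring
  have hform : star x ⬝ᵥ (coeffG (kineticF N K) lam l).mulVec x =
      ∫ ρ in Set.Ioi (0 : ℝ), C * (P.eval ρ ^ 2 * ρ ^ 2 * Real.exp (-b * ρ)) := by
    simp only [← hsq]
    rw [integral_finsetSum _ fun m _ => integrable_finsetSum _ fun n _ => hterm m n]
    simp only [dotProduct, Matrix.mulVec, Finset.mul_sum]
    refine Finset.sum_congr rfl fun m _ => ?_
    rw [integral_finsetSum _ fun n _ => hterm m n]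
    refine Finset.sum_congr rfl fun n _ => ?_
    rw [integral_const_mul, hG]
    simp
    ring
  have hint : IntegrableOn (fun ρ : ℝ => C * (P.eval ρ ^ 2 * ρ ^ 2 * Real.exp (-b * ρ)))
      (Set.Ioi 0) := by
    simp only [← hsq]
    exact integrable_finsetSum _ fun m _ => integrable_finsetSum _ fun n _ => hterm m n
  rw [hform, setIntegral_pos_iff_support_of_nonneg_ae
    (Filter.Eventually.of_forall fun ρ => by simp only [Pi.zero_apply]; positivity) hint]
  -- The integrand vanishes on the half line only at the finitely many roots of `P`.
  have hsub : Set.Ioi (0 : ℝ) \ (P.roots.toFinset : Set ℝ) ⊆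
      Function.support (fun ρ : ℝ => C * (P.eval ρ ^ 2 * ρ ^ 2 * Real.exp (-b * ρ)))
        ∩ Set.Ioi 0 := by
    rintro ρ ⟨hρ, hroot⟩
    have hρ0 : ρ ≠ 0 := (Set.mem_Ioi.1 hρ).ne'
    have hne : P.eval ρ ≠ 0 := by
      simpa [hP0] using hroot
    exact ⟨by simp only [Function.mem_support]; positivity, hρ⟩
  refine lt_of_lt_of_le ?_ (measure_mono hsub)
  rw [measure_sdiff_null (Finset.measure_zero _ _)]
  simp

theorem trailingNonsingular_of_posDef {N : ℕ} {G : Matrix (Fin (N + 1)) (Fin (N + 1)) ℝ}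
    (hG : G.PosDef) (j : ℕ) : TrailingNonsingular G j :=
  (hG.submatrix (e := fun i : {i : Fin (N + 1) // j ≤ i.val} => i.val)
    Subtype.val_injective).det_pos.ne'

/-! ### The section of the light cone and symmetric trace-less tensors -/

section

/-- The unit sphere of the momentum space, which parametrizes the future null directions. -/
abbrev MomentumSphere : Type := Metric.sphere (0 : EuclideanSpace ℝ (Fin 3)) 1

lemma continuous_fourMomentum (α : Fin 4) : Continuous fun p => fourMomentum p α := by
  refine Fin.cases ?_ (fun i => ?_) α
  · exact continuous_norm
  · simp only [fourMomentum, Fin.cons_succ]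
    fun_prop

/-- The energy `u_α p^α` of the momentum `p` relative to `u`. -/
def energy (u : Fin 4 → ℝ) (p : EuclideanSpace ℝ (Fin 3)) : ℝ := ∑ α, u α * fourMomentum p α

lemma continuous_energy (u : Fin 4 → ℝ) : Continuous (energy u) :=
  continuous_finsetSum _ fun α _ => (continuous_fourMomentum α).const_mul _

/-- The covector `u` is positive on all future null vectors. -/
def IsFuture (u : Fin 4 → ℝ) : Prop := ∀ ω : MomentumSphere, 0 < energy u ω

lemma gam_mul_velocity {l : Fin 4 → ℝ} (hl : mink l l < 0) (α : Fin 4) :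
    gam l * velocity l α = l α := by
  rw [velocity, mul_inv_cancel_left₀ (gam_pos hl).ne']

lemma isFuture_velocity {l : Fin 4 → ℝ} (hl : mink l l < 0) (hl0 : 0 < l 0) :
    IsFuture (velocity l) := by
  intro ω
  have hω : (ω : EuclideanSpace ℝ (Fin 3)) 0 ^ 2 + (ω : EuclideanSpace ℝ (Fin 3)) 1 ^ 2
      + (ω : EuclideanSpace ℝ (Fin 3)) 2 ^ 2 = 1 := by
    have h := EuclideanSpace.norm_sq_eq (ω : EuclideanSpace ℝ (Fin 3))
    rw [norm_eq_of_mem_sphere] at h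
    simp only [Real.norm_eq_abs, sq_abs, Fin.sum_univ_three] at h
    linarith
  have hE : energy (velocity l) ω = (gam l)⁻¹ * (l 0 + (l 1 * (ω : EuclideanSpace ℝ (Fin 3)) 0
      + l 2 * (ω : EuclideanSpace ℝ (Fin 3)) 1 + l 3 * (ω : EuclideanSpace ℝ (Fin 3)) 2)) := by
    have h1 : fourMomentum ω 1 = (ω : EuclideanSpace ℝ (Fin 3)) 0 := rfl
    have h2 : fourMomentum ω 2 = (ω : EuclideanSpace ℝ (Fin 3)) 1 := rfl
    have h3 : fourMomentum ω 3 = (ω : EuclideanSpace ℝ (Fin 3)) 2 := rfl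
    have h0 : fourMomentum ω 0 = 1 := norm_eq_of_mem_sphere ω
    simp only [energy, velocity, Fin.sum_univ_four, h0, h1, h2, h3]
    ring
  have hm : l 1 ^ 2 + l 2 ^ 2 + l 3 ^ 2 < l 0 ^ 2 := by
    simp [mink, metric, Fin.sum_univ_four] at hl
    nlinarith
  rw [hE]
  refine mul_pos (inv_pos.2 (gam_pos hl)) ?_
  set x := (ω : EuclideanSpace ℝ (Fin 3)) 0
  set y := (ω : EuclideanSpace ℝ (Fin 3)) 1
  set z := (ω : EuclideanSpace ℝ (Fin 3)) 2
  have hcs : (l 1 * x + l 2 * y + l 3 * z) ^ 2 < l 0 ^ 2 := by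
    nlinarith [sq_nonneg (l 1 * y - l 2 * x), sq_nonneg (l 1 * z - l 3 * x),
      sq_nonneg (l 2 * z - l 3 * y)]
  have := abs_lt_of_sq_lt_sq hcs hl0.le
  linarith [(abs_lt.1 this).1]

variable {u : Fin 4 → ℝ}

/-- The component `q^α` of the null vector `q(ω) = (1, ω) / u_β (1, ω)^β`, which is the multiple
of `(1, ω)` with `u_α q^α = 1`. -/
def coneCoord (hu : IsFuture u) (α : Fin 4) : C(MomentumSphere, ℝ) where
  toFun ω := fourMomentum ω α / energy u ω
  continuous_toFun := ((continuous_fourMomentum α).comp continuous_subtype_val).div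
    ((continuous_energy u).comp continuous_subtype_val) fun ω => (hu ω).ne'

lemma coneCoord_apply (hu : IsFuture u) (α : Fin 4) (ω : MomentumSphere) :
    coneCoord hu α ω = fourMomentum ω α / energy u ω := rfl

lemma sum_mul_coneCoord (hu : IsFuture u) : ∑ α, u α • coneCoord hu α = 1 := by
  ext ω
  simp only [ContinuousMap.coe_sum, Finset.sum_apply, ContinuousMap.smul_apply, coneCoord_apply,
    smul_eq_mul, ContinuousMap.one_apply, mul_div_assoc', ← Finset.sum_div]
  exact div_self (hu ω).ne'

lemma mink_coneCoord (hu : IsFuture u) (ω : MomentumSphere) :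
    ∑ μ, metric μ * (coneCoord hu μ ω * coneCoord hu μ ω) = 0 := by
  have h := EuclideanSpace.norm_sq_eq (ω : EuclideanSpace ℝ (Fin 3))
  simp only [Real.norm_eq_abs, sq_abs] at h
  have h2 : ∑ μ, metric μ * (fourMomentum ω μ * fourMomentum ω μ) = 0 := by
    rw [Fin.sum_univ_succ]
    simp only [metric, fourMomentum, if_true, Fin.cons_zero, Fin.cons_succ, Fin.succ_ne_zero,
      if_false, one_mul, ← sq, ← h]
    ring
  have h3 : ∀ μ, metric μ * (coneCoord hu μ ω * coneCoord hu μ ω) =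
      metric μ * (fourMomentum ω μ * fourMomentum ω μ) / energy u ω ^ 2 := fun μ => by
    rw [coneCoord_apply]
    ring
  rw [Finset.sum_congr rfl fun μ _ => h3 μ, ← Finset.sum_div, h2, zero_div]

/-- The restriction of the form `T(q, …, q)` to the null vectors `q(ω)`. -/
def tensorFn (hu : IsFuture u) (n : ℕ) : ((Fin n → Fin 4) → ℝ) →ₗ[ℝ] C(MomentumSphere, ℝ) where
  toFun T := ∑ β, T β • ∏ i, coneCoord hu (β i)
  map_add' S T := by simp only [Pi.add_apply, add_smul, Finset.sum_add_distrib]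
  map_smul' c T := by
    simp only [Pi.smul_apply, smul_eq_mul, mul_smul, Finset.smul_sum, RingHom.id_apply]

lemma tensorFn_apply (hu : IsFuture u) {n : ℕ} (T : (Fin n → Fin 4) → ℝ) :
    tensorFn hu n T = ∑ β, T β • ∏ i, coneCoord hu (β i) := rfl

/-- The span of the functions `q^α`. Its powers `coneSpan hu ^ n` are the spaces of polynomials of
degree `n` in `q`; they increase with `n` because `u_α q^α = 1`. -/
def coneSpan (hu : IsFuture u) : Submodule ℝ C(MomentumSphere, ℝ) :=
  Submodule.span ℝ (Set.range (coneCoord hu))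

lemma coneSpan_pow (hu : IsFuture u) (n : ℕ) : coneSpan hu ^ n =
    Submodule.span ℝ (Set.range fun a : Fin n → Fin 4 => ∏ i, coneCoord hu (a i)) := by
  rw [coneSpan, Submodule.span_pow]
  congr 1
  ext f
  rw [Set.mem_pow, Set.mem_range]
  constructor
  · rintro ⟨g, rfl⟩
    choose a ha using fun i => (g i).2
    exact ⟨a, by simp only [List.prod_ofFn, ha]⟩
  · rintro ⟨a, rfl⟩
    exact ⟨fun i => ⟨_, a i, rfl⟩, by simp [List.prod_ofFn]⟩

lemma range_tensorFn (hu : IsFuture u) (n : ℕ) :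
    LinearMap.range (tensorFn hu n) = coneSpan hu ^ n := by
  rw [coneSpan_pow]
  apply le_antisymm
  · rintro _ ⟨T, rfl⟩
    rw [tensorFn_apply]
    exact Submodule.sum_mem _ fun β _ =>
      Submodule.smul_mem _ _ (Submodule.subset_span ⟨β, rfl⟩)
  · rw [Submodule.span_le]
    rintro _ ⟨a, rfl⟩
    exact ⟨Pi.single a 1, by simp [tensorFn_apply, Pi.single_apply]⟩

instance finiteDimensional_coneSpan_pow (hu : IsFuture u) (n : ℕ) :
    FiniteDimensional ℝ ↥(coneSpan hu ^ n) := by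
  rw [← range_tensorFn]
  infer_instance

lemma one_le_coneSpan (hu : IsFuture u) : 1 ≤ coneSpan hu := by
  rw [Submodule.one_le, ← sum_mul_coneCoord hu]
  exact Submodule.sum_mem _ fun α _ =>
    Submodule.smul_mem _ _ (Submodule.subset_span ⟨α, rfl⟩)

lemma coneSpan_pow_mono (hu : IsFuture u) : Monotone fun n : ℕ => coneSpan hu ^ n :=
  pow_right_monotone (one_le_coneSpan hu)

lemma infinite_momentumSphere : Infinite MomentumSphere := by
  refine Set.infinite_coe_iff.2 ?_
  have hc := isPreconnected_sphere (E := EuclideanSpace ℝ (Fin 3))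
    (by rw [rank_eq_card_basis (EuclideanSpace.basisFun (Fin 3) ℝ).toBasis]; norm_num) 0 1
  refine hc.infinite_of_nontrivial ⟨EuclideanSpace.single 0 1, by simp,
    EuclideanSpace.single 1 1, by simp, fun h => ?_⟩
  have := congrArg (fun v : EuclideanSpace ℝ (Fin 3) => v 0) h
  simp at this

/-- If `coneSpan hu ^ j` absorbed the next power, it would be a finite-dimensional algebra, the
functions `q^α` would be integral over `ℝ`, and so would take finitely many values only. -/
lemma not_coneSpan_pow_succ_le (hu : IsFuture u) (j : ℕ) :
    ¬ coneSpan hu ^ (j + 1) ≤ coneSpan hu ^ j := by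
  intro hle
  have hk : ∀ k, coneSpan hu ^ k ≤ coneSpan hu ^ j := by
    intro k
    induction k with
    | zero => exact coneSpan_pow_mono hu (Nat.zero_le j)
    | succ k ih =>
      rw [pow_succ]
      exact (mul_le_mul' ih le_rfl).trans (by rwa [← pow_succ])
  let A : Subalgebra ℝ C(MomentumSphere, ℝ) := (coneSpan hu ^ j).toSubalgebra
    (Submodule.one_le.1 (by simpa using hk 0))
    fun x y hx hy => hk (j + j) (by rw [pow_add]; exact Submodule.mul_mem_mul hx hy)
  have hA : A.toSubmodule.FG := (Module.Finite.iff_fg (N := coneSpan hu ^ j)).1 inferInstance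
  have hfin : ∀ α, (Set.range (coneCoord hu α)).Finite := by
    intro α
    have hmem : coneCoord hu α ∈ A := hk 1 (by
      rw [pow_one]; exact Submodule.subset_span ⟨α, rfl⟩)
    obtain ⟨P, hP, hroot⟩ := IsIntegral.of_mem_of_fg A hA _ hmem
    refine (P.roots.toFinset.finite_toSet).subset ?_
    rintro _ ⟨ω, rfl⟩
    have := congrArg (fun f : C(MomentumSphere, ℝ) => f ω)
      (show Polynomial.aeval (coneCoord hu α) P = 0 from hroot)
    simp only [Polynomial.aeval_continuousMap_apply] at this
    simpa [hP.ne_zero] using this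
  have hinj : Function.Injective fun (ω : MomentumSphere) α => coneCoord hu α ω := by
    intro ω ω' h
    have h0 : ∀ ω : MomentumSphere, fourMomentum ω 0 = 1 := fun ω => norm_eq_of_mem_sphere ω
    have hE : energy u ω = energy u ω' := by
      have := congrFun h 0
      simp only [coneCoord_apply, h0, one_div] at this
      exact inv_injective this
    refine Subtype.ext (PiLp.ext fun i => ?_)
    have := congrFun h i.succ
    simp only [coneCoord_apply, hE] at this
    exact (div_left_inj' (hu ω').ne').1 this
  have := infinite_momentumSphere
  refine Set.infinite_range_of_injective hinj ((Set.Finite.pi' hfin).subset ?_)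
  rintro _ ⟨ω, rfl⟩ α
  exact ⟨ω, rfl⟩

/-- The symmetric trace-less tensors of rank `n`. -/
def tracelessSymm (n : ℕ) : Submodule ℝ ((Fin n → Fin 4) → ℝ) where
  carrier := {T | IsSymm T ∧ IsTraceless T}
  add_mem' {S T} hS hT := by
    refine ⟨fun σ β => ?_, fun i j hij β => ?_⟩
    · rw [Pi.add_apply, Pi.add_apply, hS.1, hT.1]
    · simp only [Pi.add_apply, mul_add, Finset.sum_add_distrib, hS.2 i j hij, hT.2 i j hij,
        add_zero]
  zero_mem' := ⟨fun _ _ => rfl, fun i j _ β => by simp⟩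
  smul_mem' c T hT := by
    refine ⟨fun σ β => ?_, fun i j hij β => ?_⟩
    · rw [Pi.smul_apply, Pi.smul_apply, hT.1]
    · simp only [Pi.smul_apply, smul_eq_mul, mul_left_comm _ c, ← Finset.mul_sum, hT.2 i j hij,
        mul_zero]

/-- The powers of a null vector are symmetric trace-less tensors. -/
lemma prod_coneCoord_mem_tracelessSymm (hu : IsFuture u) (n : ℕ) (ω : MomentumSphere) :
    (fun β : Fin n → Fin 4 => ∏ i, coneCoord hu (β i) ω) ∈ tracelessSymm n := by
  refine ⟨fun σ β => ?_, fun i j hij β => ?_⟩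
  · exact Equiv.prod_comp σ fun i => coneCoord hu (β i) ω
  · have : ∀ μ, metric μ * ∏ k, coneCoord hu (Function.update (Function.update β i μ) j μ k) ω =
        (metric μ * (coneCoord hu μ ω * coneCoord hu μ ω)) *
          ∏ k ∈ (Finset.univ.erase j).erase i, coneCoord hu (β k) ω := by
      intro μ
      rw [← Finset.mul_prod_erase Finset.univ _ (Finset.mem_univ j),
        ← Finset.mul_prod_erase (Finset.univ.erase j) _
          (Finset.mem_erase.2 ⟨hij, Finset.mem_univ i⟩)]
      have hrest : ∏ k ∈ (Finset.univ.erase j).erase i,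
          coneCoord hu (Function.update (Function.update β i μ) j μ k) ω =
          ∏ k ∈ (Finset.univ.erase j).erase i, coneCoord hu (β k) ω := by
        refine Finset.prod_congr rfl fun k hk => ?_
        simp only [Finset.mem_erase] at hk
        rw [Function.update_of_ne hk.2.1, Function.update_of_ne hk.1]
      rw [hrest, Function.update_self, Function.update_of_ne hij, Function.update_self]
      ring
    simp only [this, ← Finset.sum_mul, mink_coneCoord, zero_mul]

/-- Every polynomial of degree `n` in `q` is `T(q, …, q)` for a symmetric trace-less tensor `T`:
project a coefficient tensor orthogonally onto those tensors, to which the powers of `q` belong. -/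
lemma exists_tracelessSymm_tensorFn_eq (hu : IsFuture u) {n : ℕ} {f : C(MomentumSphere, ℝ)}
    (hf : f ∈ coneSpan hu ^ n) : ∃ T ∈ tracelessSymm n, tensorFn hu n T = f := by
  rw [← range_tensorFn] at hf
  obtain ⟨c, rfl⟩ := hf
  let e := WithLp.linearEquiv 2 ℝ ((Fin n → Fin 4) → ℝ)
  let W : Submodule ℝ (EuclideanSpace ℝ (Fin n → Fin 4)) := (tracelessSymm n).comap e.toLinearMap
  obtain ⟨y, hy, z, hz, hyz⟩ := W.exists_add_mem_mem_orthogonal (WithLp.toLp 2 c)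
  refine ⟨e y, hy, ?_⟩
  have hc : c = e y + e z := by
    rw [← map_add, ← hyz]
    rfl
  suffices hez : tensorFn hu n (e z) = 0 by rw [hc, map_add, hez, add_zero]
  ext ω
  have := (Submodule.mem_orthogonal _ _).1 hz
    (WithLp.toLp 2 fun β : Fin n → Fin 4 => ∏ i, coneCoord hu (β i) ω)
    (prod_coneCoord_mem_tracelessSymm hu n ω)
  rw [PiLp.inner_apply] at this
  simpa [tensorFn_apply, e, ContinuousMap.coe_sum, ContinuousMap.coe_prod, Finset.sum_apply,
    Finset.prod_apply] using this

end

/-! ### The field equations at equilibrium -/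

/-- The surface measure of the unit sphere of the momentum space. -/
abbrev sphereMeasure : Measure MomentumSphere :=
  (volume : Measure (EuclideanSpace ℝ (Fin 3))).toSphere

lemma integral_volumeIoiPow (k : ℕ) (ψ : ℝ → ℝ) :
    ∫ r : Set.Ioi (0 : ℝ), ψ r ∂(Measure.volumeIoiPow k) = ∫ r in Set.Ioi (0 : ℝ), r ^ k * ψ r := by
  simp only [Measure.volumeIoiPow, ENNReal.ofReal]
  rw [integral_withDensity_eq_integral_smul
      ((measurable_subtype_coe.pow_const _).real_toNNReal),
    integral_subtype_comap measurableSet_Ioi fun a => Real.toNNReal (a ^ k) • ψ a]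
  refine setIntegral_congr_fun measurableSet_Ioi fun x hx => ?_
  simp only [NNReal.smul_def, Real.coe_toNNReal _ (pow_nonneg (Set.mem_Ioi.1 hx).le _),
    smul_eq_mul]

lemma integrable_volumeIoiPow_iff (k : ℕ) (ψ : ℝ → ℝ) :
    Integrable (fun r : Set.Ioi (0 : ℝ) => ψ r) (Measure.volumeIoiPow k) ↔
      IntegrableOn (fun r : ℝ => r ^ k * ψ r) (Set.Ioi 0) := by
  rw [Measure.volumeIoiPow, integrable_withDensity_iff_integrable_smul' (by fun_prop) (by simp),
    integrableOn_iff_comap_subtypeVal measurableSet_Ioi]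
  refine integrable_congr (.of_forall ?_)
  rintro ⟨x, hx : 0 < x⟩
  simp (disch := positivity) [ENNReal.toReal_ofReal]

lemma integral_eq_integral_sphere_prod (Φ : EuclideanSpace ℝ (Fin 3) → ℝ) :
    ∫ p, Φ p = ∫ x : MomentumSphere × Set.Ioi (0 : ℝ), Φ (x.2.1 • x.1.1)
      ∂(sphereMeasure.prod (Measure.volumeIoiPow 2)) := by
  have hpres := (volume : Measure (EuclideanSpace ℝ (Fin 3))
    ).measurePreserving_homeomorphUnitSphereProd
  rw [finrank_euclideanSpace_fin] at hpres
  have := hpres.integral_comp (Homeomorph.measurableEmbedding _)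
    fun x : MomentumSphere × Set.Ioi (0 : ℝ) => Φ (x.2.1 • x.1.1)
  rw [← this]
  trans ∫ p : ({0}ᶜ : Set (EuclideanSpace ℝ (Fin 3))), Φ p.1 ∂(volume.comap Subtype.val)
  · rw [integral_subtype_comap (measurableSet_singleton _).compl Φ, restrict_compl_singleton]
  · refine integral_congr_ae (.of_forall ?_)
    rintro ⟨p, hp⟩
    have hp' : ‖p‖ ≠ 0 := norm_ne_zero_iff.2 hp
    simp [smul_smul, hp']

lemma radial_integral (g : ℝ → ℝ) (k : ℕ) {s : ℝ} (hs : 0 < s) :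
    ∫ r in Set.Ioi (0 : ℝ), g (r * s) * r ^ k =
      (s ^ (k + 1))⁻¹ * ∫ ρ in Set.Ioi (0 : ℝ), g ρ * ρ ^ k := by
  have := integral_comp_mul_right_Ioi (fun ρ => g ρ * ρ ^ k) 0 hs
  rw [zero_mul, smul_eq_mul] at this
  rw [pow_succ, mul_inv, mul_assoc, ← this, ← integral_const_mul]
  refine setIntegral_congr_fun measurableSet_Ioi fun r _ => ?_
  field_simp
  ring

lemma integrableOn_radial {g : ℝ → ℝ} {k : ℕ}
    (hg : IntegrableOn (fun ρ => g ρ * ρ ^ k) (Set.Ioi 0)) {s : ℝ} (hs : 0 < s) :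
    IntegrableOn (fun r => g (r * s) * r ^ k) (Set.Ioi 0) := by
  have := (integrableOn_Ioi_comp_mul_right_iff (fun ρ => g ρ * ρ ^ k) 0 hs).2 (by simpa using hg)
  refine (this.const_mul (s ^ k)⁻¹).congr (.of_forall fun r => ?_)
  simp only
  field_simp
  ring

/-- Polar coordinates for an integrand that depends on the radius through the energy `r * s ω`:
rescaling the radius separates the radial integral from the angular one. -/
theorem integral_polar {Φ : EuclideanSpace ℝ (Fin 3) → ℝ} {g : ℝ → ℝ} {k : ℕ}
    (s H : C(MomentumSphere, ℝ)) (hs : ∀ ω, 0 < s ω)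
    (hg : ContinuousOn g (Set.Ioi 0)) (hgi : IntegrableOn (fun ρ => g ρ * ρ ^ k) (Set.Ioi 0))
    (hΦ : ∀ (ω : MomentumSphere) (r : ℝ), 0 < r →
      r ^ 2 * Φ (r • ω.1) = H ω * (g (r * s ω) * r ^ k)) :
    ∫ p, Φ p = (∫ ρ in Set.Ioi (0 : ℝ), g ρ * ρ ^ k) *
      ∫ ω, H ω * (s ω ^ (k + 1))⁻¹ ∂sphereMeasure := by
  have hcont : Continuous fun ω => (s ω ^ (k + 1))⁻¹ :=
    (s.continuous.pow _).inv₀ fun ω => (pow_pos (hs ω) _).ne'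
  have hmeas : AEStronglyMeasurable
      (fun x : MomentumSphere × Set.Ioi (0 : ℝ) => Φ (x.2.1 • x.1.1))
      (sphereMeasure.prod (Measure.volumeIoiPow 2)) := by
    have heq : (fun x : MomentumSphere × Set.Ioi (0 : ℝ) => Φ (x.2.1 • x.1.1)) =
        fun x => H x.1 * (g (x.2.1 * s x.1) * x.2.1 ^ k) / x.2.1 ^ 2 := by
      funext x
      rw [← hΦ x.1 x.2.1 x.2.2, mul_div_cancel_left₀ _ (pow_pos x.2.2 2).ne']
    rw [heq]
    refine Continuous.aestronglyMeasurable (Continuous.div ?_ (by fun_prop)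
      fun x => (pow_pos x.2.2 2).ne')
    refine (by fun_prop : Continuous fun x : MomentumSphere × Set.Ioi (0 : ℝ) => H x.1).mul
      (Continuous.mul ?_ (by fun_prop))
    exact hg.comp_continuous (by fun_prop) fun x => mul_pos x.2.2 (hs _)
  have hinner : ∀ ω : MomentumSphere,
      Integrable (fun r : Set.Ioi (0 : ℝ) => Φ (r.1 • ω.1)) (Measure.volumeIoiPow 2) := by
    intro ω
    rw [integrable_volumeIoiPow_iff 2 fun r => Φ (r • ω.1)]
    exact IntegrableOn.congr_fun ((integrableOn_radial hgi (hs ω)).const_mul (H ω))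
      (fun r hr => (hΦ ω r hr).symm) measurableSet_Ioi
  have hnorm : ∀ ω : MomentumSphere, ∫ r : Set.Ioi (0 : ℝ), ‖Φ (r.1 • ω.1)‖
      ∂(Measure.volumeIoiPow 2) =
        |H ω| * ((s ω ^ (k + 1))⁻¹ * ∫ ρ in Set.Ioi (0 : ℝ), |g ρ| * ρ ^ k) := by
    intro ω
    rw [integral_volumeIoiPow 2 fun r => ‖Φ (r • ω.1)‖,
      ← radial_integral (fun ρ => |g ρ|) k (hs ω), ← integral_const_mul]
    refine setIntegral_congr_fun measurableSet_Ioi fun r hr => ?_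
    have hr' : 0 < r := hr
    have := congrArg abs (hΦ ω r hr)
    rw [abs_mul, abs_mul, abs_mul, abs_of_pos (pow_pos hr' 2), abs_of_pos (pow_pos hr' k)] at this
    exact this
  have hint : Integrable (fun x : MomentumSphere × Set.Ioi (0 : ℝ) => Φ (x.2.1 • x.1.1))
      (sphereMeasure.prod (Measure.volumeIoiPow 2)) := by
    rw [integrable_prod_iff hmeas]
    refine ⟨.of_forall hinner, ?_⟩
    simp only [hnorm]
    exact (Continuous.integrable_of_hasCompactSupport
      ((H.continuous.abs).mul (hcont.mul continuous_const)) (HasCompactSupport.of_compactSpace _))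
  rw [integral_eq_integral_sphere_prod, integral_prod _ hint, ← integral_const_mul]
  refine integral_congr_ae (.of_forall fun ω => ?_)
  simp only
  rw [integral_volumeIoiPow 2 fun r => Φ (r • ω.1),
    setIntegral_congr_fun measurableSet_Ioi fun r hr => hΦ ω r hr, integral_const_mul,
    radial_integral g k (hs ω)]
  ring

lemma contract_equilibrium (lam : ℝ) (l v : Fin 4 → ℝ) (k : ℕ) :
    contract (equilibrium lam l k) v =
      if k = 0 then lam else if k = 1 then ∑ α, l α * v α else 0 := by
  match k with
  | 0 => simp [contract, equilibrium]
  | 1 =>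
    simp only [contract, equilibrium, Finset.univ_unique, Finset.prod_singleton]
    rw [← (Equiv.funUnique (Fin 1) (Fin 4)).sum_comp fun α => l α * v α]
    rfl
  | k + 2 => simp [contract, equilibrium]

lemma contract_equilibrium_fourMomentum {N : ℕ} (lam : ℝ) {l : Fin 4 → ℝ} (hl : mink l l < 0)
    (p : EuclideanSpace ℝ (Fin 3)) :
    (fun i : Fin (N + 1) => contract (equilibrium lam l i.val) (fourMomentum p)) =
      rayPoint N lam (energy (velocity l) p * gam l) := by
  funext i
  rw [contract_equilibrium, rayPoint, energy, Finset.sum_mul]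
  simp only [mul_right_comm _ _ (gam l), mul_comm _ (gam l), gam_mul_velocity hl]

lemma fourMomentum_smul {r : ℝ} (hr : 0 < r) (p : EuclideanSpace ℝ (Fin 3)) (α : Fin 4) :
    fourMomentum (r • p) α = r * fourMomentum p α := by
  refine Fin.cases ?_ (fun i => ?_) α
  · simp [fourMomentum, norm_smul, abs_of_pos hr]
  · simp [fourMomentum]

lemma continuousAt_secondPartial {N : ℕ} {F : (Fin (N + 1) → ℝ) → ℝ} {x : Fin (N + 1) → ℝ}
    (hF : ContDiffAt ℝ 2 F x) (m n : Fin (N + 1)) : ContinuousAt (secondPartial F m n) x := by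
  have h1 : ContDiffAt ℝ 1 (fderiv ℝ F) x := hF.fderiv_right (by norm_num)
  have h2 : ContDiffAt ℝ 1 (fun y => fderiv ℝ F y (Pi.single n 1)) x :=
    h1.clm_apply contDiffAt_const
  have h3 : ContDiffAt ℝ 0 (fderiv ℝ fun y => fderiv ℝ F y (Pi.single n 1)) x :=
    h2.fderiv_right (by norm_num)
  exact (h3.clm_apply contDiffAt_const).continuousAt

/-- The regularity of a generating function `F` near the equilibrium states: it is twice
continuously differentiable there and the coefficients `G_{m,n}` converge absolutely. -/
structure RegularOnRay {N : ℕ} (F : (Fin (N + 1) → ℝ) → ℝ) (lam : ℝ) (l : Fin 4 → ℝ) : Prop where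
  contDiffAt : ∀ x : ℝ, 0 < x → ContDiffAt ℝ 2 F (rayPoint N lam x)
  integrableOn : ∀ m n : Fin (N + 1), IntegrableOn
    (fun ρ : ℝ => secondPartial F m n (rayPoint N lam (ρ * gam l)) * ρ ^ (m.val + n.val + 2))
    (Set.Ioi 0)

/-- The integral over the sphere for the measure `(q^0)^2 dω = dω / (u_α (1, ω)^α)^2`, which the
rescaling of the radius leaves on the section `u_α q^α = 1` of the light cone. -/
def coneIntegral {u : Fin 4 → ℝ} (hu : IsFuture u) : C(MomentumSphere, ℝ) →ₗ[ℝ] ℝ where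
  toFun f := ∫ ω, f ω * coneCoord hu 0 ω ^ 2 ∂sphereMeasure
  map_add' f g := by
    simp only [ContinuousMap.add_apply, add_mul]
    exact integral_add
      (Continuous.integrable_of_hasCompactSupport (by fun_prop) (.of_compactSpace _))
      (Continuous.integrable_of_hasCompactSupport (by fun_prop) (.of_compactSpace _))
  map_smul' c f := by
    simp only [ContinuousMap.smul_apply, smul_eq_mul, mul_assoc, integral_const_mul,
      RingHom.id_apply]

/-- The coefficients of the field equations at equilibrium: the generating function only enters
through `G_{m,n}`. -/
theorem fluxTensor_equilibrium {N : ℕ} {F : (Fin (N + 1) → ℝ) → ℝ} {lam : ℝ} {l : Fin 4 → ℝ}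
    (hF : RegularOnRay F lam l) (hl : mink l l < 0) (hu : IsFuture (velocity l))
    (m n : Fin (N + 1)) (α : Fin 4) (a : Fin m.val → Fin 4) (b : Fin n.val → Fin 4) :
    fluxTensor F (equilibrium lam l) m n α a b = coeffG F lam l m n *
      coneIntegral hu (coneCoord hu α * (∏ i, coneCoord hu (a i)) * ∏ i, coneCoord hu (b i)) := by
  have hγ := gam_pos hl
  let s : C(MomentumSphere, ℝ) :=
    ⟨fun ω => energy (velocity l) ω, (continuous_energy _).comp continuous_subtype_val⟩
  let P : Fin 4 → C(MomentumSphere, ℝ) := fun α =>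
    ⟨fun ω => fourMomentum ω α, (continuous_fourMomentum α).comp continuous_subtype_val⟩
  let H : C(MomentumSphere, ℝ) := P α * (∏ i, P (a i)) * ∏ i, P (b i)
  have hH : ∀ ω : MomentumSphere, H ω = fourMomentum ω α * (∏ i, fourMomentum ω (a i)) *
      ∏ i, fourMomentum ω (b i) := fun ω => by
    simp [H, P, ContinuousMap.coe_prod, Finset.prod_apply]
  have h0 : ∀ ω : MomentumSphere, fourMomentum ω 0 = 1 := fun ω => norm_eq_of_mem_sphere ω
  have hg : ContinuousOn
      (fun ρ : ℝ => secondPartial F m n (rayPoint N lam (ρ * gam l))) (Set.Ioi 0) := by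
    intro ρ hρ
    have hray : Continuous fun ρ : ℝ => rayPoint N lam (ρ * gam l) := by
      refine continuous_pi fun i => ?_
      unfold rayPoint
      split_ifs <;> fun_prop
    exact (ContinuousAt.comp (f := fun ρ : ℝ => rayPoint N lam (ρ * gam l))
      (continuousAt_secondPartial (hF.contDiffAt _ (mul_pos hρ hγ)) m n)
      hray.continuousAt).continuousWithinAt
  rw [fluxTensor, integral_polar s H hu hg (hF.integrableOn m n)]
  · rw [coeffG]
    congr 1
    refine integral_congr_ae (.of_forall fun ω => ?_)
    have hs : (s ω : ℝ) ≠ 0 := (hu ω).ne'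
    simp only [hH, ContinuousMap.mul_apply, ContinuousMap.coe_prod, Finset.prod_apply,
      coneCoord_apply, h0, Finset.prod_div_distrib, Finset.prod_const, Finset.card_univ,
      Fintype.card_fin]
    change _ * (s ω ^ _)⁻¹ = _ / s ω * (_ / s ω ^ _) * (_ / s ω ^ _) * (1 / s ω) ^ 2
    field_simp
    ring
  · intro ω r hr
    have hE : energy (velocity l) (r • ω.1) = r * s ω := by
      simp only [energy, fourMomentum_smul hr, s, ContinuousMap.coe_mk, Finset.mul_sum,
        mul_left_comm r]
    simp only [contract_equilibrium_fourMomentum lam hl, hE, hH, fourMomentum_smul hr, h0,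
      Finset.prod_mul_distrib, Finset.prod_const, Finset.card_univ, Fintype.card_fin]
    field_simp
    ring

/-! ### Hyperbolicity and wave speeds -/

section

/-- The function `ϕ_α q^α` on the sphere. -/
def coneForm {u : Fin 4 → ℝ} (hu : IsFuture u) (ϕ : Fin 4 → ℝ) : C(MomentumSphere, ℝ) :=
  ∑ α, ϕ α • coneCoord hu α

/-- The pairing of a tensor of rank `n` with a test function, weighted by `ϕ_α q^α`. -/
def conePairing {u : Fin 4 → ℝ} (hu : IsFuture u) (ϕ : Fin 4 → ℝ) (n : ℕ) :
    ((Fin n → Fin 4) → ℝ) →ₗ[ℝ] C(MomentumSphere, ℝ) →ₗ[ℝ] ℝ :=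
  ((LinearMap.mul ℝ C(MomentumSphere, ℝ)).compr₂ (coneIntegral hu)).comp
    ((LinearMap.mulLeft ℝ (coneForm hu ϕ)).comp (tensorFn hu n))

lemma conePairing_apply {u : Fin 4 → ℝ} (hu : IsFuture u) (ϕ : Fin 4 → ℝ) {n : ℕ}
    (T : (Fin n → Fin 4) → ℝ) (ψ : C(MomentumSphere, ℝ)) :
    conePairing hu ϕ n T ψ = coneIntegral hu (coneForm hu ϕ * tensorFn hu n T * ψ) := rfl

variable {N : ℕ} {F : (Fin (N + 1) → ℝ) → ℝ} {lam : ℝ} {l : Fin 4 → ℝ}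

/-- The field equations at equilibrium, in weak form: the tensors only enter through the functions
`δ_n(q, …, q)` and the equation of index `m` is tested with the polynomials of degree `m` in `q`. -/
theorem solvesCharSystem_iff (hF : RegularOnRay F lam l) (hl : mink l l < 0)
    (hu : IsFuture (velocity l)) (ϕ : Fin 4 → ℝ) (δ : TensorFamily) :
    SolvesCharSystem F (equilibrium lam l) ϕ δ ↔ (∀ n, n ≤ N → δ n ∈ tracelessSymm n) ∧
      ∀ m : Fin (N + 1), ∀ ψ ∈ coneSpan hu ^ m.val,
        ∑ n : Fin (N + 1), coeffG F lam l m n * conePairing hu ϕ n (δ n) ψ = 0 := by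
  have hsum : ∀ (m : Fin (N + 1)) (a : Fin m.val → Fin 4),
      ∑ n : Fin (N + 1), ∑ b : Fin n.val → Fin 4, ∑ α : Fin 4,
        ϕ α * fluxTensor F (equilibrium lam l) m n α a b * δ n.val b =
      ∑ n : Fin (N + 1), coeffG F lam l m n *
        conePairing hu ϕ n (δ n) (∏ i, coneCoord hu (a i)) := by
    intro m a
    refine Finset.sum_congr rfl fun n _ => ?_
    simp only [fluxTensor_equilibrium hF hl hu, conePairing_apply, tensorFn_apply, coneForm,
      Finset.sum_mul, Finset.mul_sum, map_sum, smul_mul_assoc, mul_smul_comm, map_smul, smul_eq_mul]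
    refine Finset.sum_congr rfl fun b _ => Finset.sum_congr rfl fun α _ => ?_
    rw [mul_right_comm (coneCoord hu α)]
    ring
  refine and_congr Iff.rfl (forall_congr' fun m => ?_)
  simp only [hsum]
  constructor
  · intro h ψ hψ
    rw [coneSpan_pow] at hψ
    induction hψ using Submodule.span_induction with
    | mem ψ hψ =>
      obtain ⟨a, rfl⟩ := hψ
      exact h a
    | zero => simp
    | add ψ ψ' _ _ h h' => simp only [map_add, mul_add, Finset.sum_add_distrib, h, h', add_zero]
    | smul c ψ _ h =>
      simp only [map_smul, smul_eq_mul, mul_left_comm _ c, ← Finset.mul_sum, h, mul_zero]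
  · intro h a
    refine h _ ?_
    rw [coneSpan_pow]
    exact Submodule.subset_span ⟨a, rfl⟩

/-- Extension of the tensors of rank at most `N` by zero. -/
def extendTensors (x : ∀ n : Fin (N + 1), (Fin n.val → Fin 4) → ℝ) : TensorFamily :=
  fun n => if hn : n < N + 1 then x ⟨n, hn⟩ else 0

lemma extendTensors_apply (x : ∀ n : Fin (N + 1), (Fin n.val → Fin 4) → ℝ) (n : Fin (N + 1)) :
    extendTensors x n.val = x n := by
  rw [extendTensors, dif_pos n.2]

/-- A tensor whose form vanishes on the cone solves the field equations in every direction, so the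
first condition of hyperbolicity makes symmetric trace-less tensors determined by their values on
the cone. -/
lemma tensorFn_injOn_of_hyperbolicity (hF : RegularOnRay F lam l) (hl : mink l l < 0)
    (hu : IsFuture (velocity l))
    (hyp : HyperbolicityCondOne F (equilibrium lam l) (velocity l)) (n : Fin (N + 1))
    {T : (Fin n.val → Fin 4) → ℝ} (hT : T ∈ tracelessSymm n.val) (h0 : tensorFn hu n T = 0) :
    T = 0 := by
  have hδ : ∀ k, extendTensors (Pi.single n T) k ∈ tracelessSymm k ∧
      tensorFn hu k (extendTensors (Pi.single n T) k) = 0 := by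
    intro k
    by_cases hk : k < N + 1
    · have := extendTensors_apply (Pi.single n T) ⟨k, hk⟩
      simp only at this
      rw [this]
      by_cases hkn : (⟨k, hk⟩ : Fin (N + 1)) = n
      · subst hkn
        simpa using ⟨hT, h0⟩
      · rw [Pi.single_eq_of_ne hkn]
        exact ⟨Submodule.zero_mem _, map_zero _⟩
    · rw [extendTensors, dif_neg hk]
      exact ⟨Submodule.zero_mem _, map_zero _⟩
  have := hyp (extendTensors (Pi.single n T)) ((solvesCharSystem_iff hF hl hu _ _).2
    ⟨fun k _ => (hδ k).1, fun m ψ _ => Finset.sum_eq_zero fun k _ => by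
      rw [conePairing_apply, (hδ k).2]
      simp⟩) n (Nat.lt_succ_iff.1 n.2)
  rwa [extendTensors_apply, Pi.single_eq_same] at this

/-- There is a polynomial of degree `j` in `q` orthogonal to those of smaller degree. -/
lemma exists_orthogonal {u : Fin 4 → ℝ} (hu : IsFuture u) (j : ℕ) :
    ∃ h ∈ coneSpan hu ^ j, h ≠ 0 ∧
      ∀ i < j, ∀ ψ ∈ coneSpan hu ^ i, coneIntegral hu (h * ψ) = 0 := by
  cases j with
  | zero =>
    refine ⟨1, by rw [pow_zero]; exact Submodule.one_le.1 le_rfl, fun h0 => ?_,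
      fun i hi => absurd hi (by simp)⟩
    obtain ⟨ω⟩ := infinite_momentumSphere.nonempty
    simpa using congrArg (fun f : C(MomentumSphere, ℝ) => f ω) h0
  | succ j =>
    let B : ↥(coneSpan hu ^ (j + 1)) →ₗ[ℝ] Module.Dual ℝ ↥(coneSpan hu ^ j) :=
      ((LinearMap.lcomp ℝ ℝ (coneSpan hu ^ j).subtype).comp
        ((LinearMap.mul ℝ C(MomentumSphere, ℝ)).compr₂ (coneIntegral hu))).comp
          (coneSpan hu ^ (j + 1)).subtype
    have hlt : coneSpan hu ^ j < coneSpan hu ^ (j + 1) :=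
      lt_of_le_not_ge (coneSpan_pow_mono hu (Nat.le_succ j)) (not_coneSpan_pow_succ_le hu j)
    have hker : LinearMap.ker B ≠ ⊥ := LinearMap.ker_ne_bot_of_finrank_lt (by
      rw [Subspace.dual_finrank_eq]
      exact Submodule.finrank_lt_finrank_of_lt hlt)
    obtain ⟨h, hB, hne⟩ := Submodule.exists_mem_ne_zero_of_ne_bot hker
    refine ⟨h, h.2, fun h0 => hne (Subtype.ext h0), fun i hi ψ hψ => ?_⟩
    have := LinearMap.congr_fun (LinearMap.mem_ker.1 hB)
      ⟨ψ, coneSpan_pow_mono hu (Nat.lt_succ_iff.1 hi) hψ⟩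
    exact this

/-- If `v` were in the kernel of a trailing block of `G`, then the tensors representing `v n • h`,
with `h` of degree `j` orthogonal to the smaller degrees, would solve the equations along `u`. -/
theorem trailingNonsingular_of_hyperbolicity (hF : RegularOnRay F lam l) (hl : mink l l < 0)
    (hu : IsFuture (velocity l))
    (hyp : HyperbolicityCondOne F (equilibrium lam l) (velocity l)) (j : ℕ) :
    TrailingNonsingular (coeffG F lam l) j := by
  rw [trailingNonsingular_iff]
  intro v hv hGv
  obtain ⟨h, hj, hne, horth⟩ := exists_orthogonal hu j
  have hT : ∀ n : Fin (N + 1), ∃ T ∈ tracelessSymm n.val, tensorFn hu n T = v n • h := by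
    intro n
    by_cases hn : n.val < j
    · exact ⟨0, Submodule.zero_mem _, by rw [hv n hn, map_zero, zero_smul]⟩
    · exact exists_tracelessSymm_tensorFn_eq hu
        (Submodule.smul_mem _ _ (coneSpan_pow_mono hu (not_lt.1 hn) hj))
  choose T hTs hTv using hT
  have hone : coneForm hu (velocity l) = 1 := sum_mul_coneCoord hu
  have hsol := hyp (extendTensors T) ((solvesCharSystem_iff hF hl hu _ _).2
    ⟨fun n hn => ?_, fun m ψ hψ => ?_⟩)
  · funext n
    have hn := hsol n (Nat.lt_succ_iff.1 n.2)
    rw [extendTensors_apply] at hn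
    have := hTv n
    rw [hn, map_zero] at this
    exact (smul_eq_zero.1 this.symm).resolve_right hne
  · have := extendTensors_apply T ⟨n, Nat.lt_succ_iff.2 hn⟩
    simp only at this
    rw [this]
    exact hTs _
  · simp only [conePairing_apply, extendTensors_apply, hTv, hone, one_mul, smul_mul_assoc,
      map_smul, smul_eq_mul, ← mul_assoc, ← Finset.sum_mul]
    by_cases hm : m.val < j
    · rw [horth m hm ψ hψ, mul_zero]
    · rw [hGv m (not_lt.1 hm), zero_mul]

/-- The wave speeds are those of the blocks `∫ ϕ(q) δ_n(q) ψ(q) = 0` for all `ψ` of degree `n`, in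
which the generating function does not occur. -/
theorem mem_waveSpeeds_iff (hF : RegularOnRay F lam l) (hl : mink l l < 0)
    (hu : IsFuture (velocity l))
    (hinj : ∀ (n : Fin (N + 1)), ∀ T ∈ tracelessSymm n.val, tensorFn hu n T = 0 → T = 0)
    (hG : ∀ j, j ≤ N → TrailingNonsingular (coeffG F lam l) j) (ξ η : Fin 4 → ℝ) (c : ℝ) :
    c ∈ waveSpeeds F (equilibrium lam l) ξ η ↔
      ∃ n : Fin (N + 1), ∃ T : tracelessSymm n.val, T ≠ 0 ∧
        ∀ ψ ∈ coneSpan hu ^ n.val, conePairing hu (phiCov ξ η c) n T ψ = 0 := by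
  have hrank : ∀ n : Fin (N + 1), Module.finrank ℝ (tracelessSymm n.val) =
      Module.finrank ℝ ↥(coneSpan hu ^ n.val) := by
    intro n
    have hmem : ∀ T : tracelessSymm n.val, tensorFn hu n T ∈ coneSpan hu ^ n.val := fun T => by
      rw [← range_tensorFn]
      exact ⟨T, rfl⟩
    refine (LinearEquiv.ofBijective
      (((tensorFn hu n).comp (tracelessSymm n.val).subtype).codRestrict _ hmem) ⟨?_, ?_⟩).finrank_eq
    · rw [injective_iff_map_eq_zero]
      intro T hT
      exact Subtype.ext (hinj n T T.2 (congrArg Subtype.val hT))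
    · rintro ⟨f, hf⟩
      obtain ⟨T, hT, rfl⟩ := exists_tracelessSymm_tensorFn_eq hu hf
      exact ⟨⟨T, hT⟩, rfl⟩
  have key := exists_solution_iff_exists_block_solution (p := 0)
    (G := coeffG F lam l) (P := fun n : Fin (N + 1) => coneSpan hu ^ n.val)
    (U := fun n : Fin (N + 1) => tracelessSymm n.val) (fun j _ hj => hG j hj)
    (fun m n hmn => coneSpan_pow_mono hu (Fin.le_def.1 hmn)) (fun n hn => absurd hn (by simp))
    hrank (fun n => (conePairing hu (phiCov ξ η c) n).comp (tracelessSymm n.val).subtype)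
  refine Iff.trans ?_ key
  simp only [waveSpeeds, Set.mem_ofPred_eq, solvesCharSystem_iff hF hl hu]
  constructor
  · rintro ⟨δ, ⟨n, hn, hne⟩, hδ, hsys⟩
    refine ⟨fun n => ⟨δ n, hδ n (Nat.lt_succ_iff.1 n.2)⟩, fun h0 => hne ?_, hsys⟩
    exact congrArg Subtype.val (congrFun h0 ⟨n, Nat.lt_succ_iff.2 hn⟩)
  · rintro ⟨x, hx, hsys⟩
    obtain ⟨n, hn⟩ := Function.ne_iff.1 hx
    refine ⟨extendTensors fun n => x n, ⟨n, Nat.lt_succ_iff.1 n.2, ?_⟩, fun k hk => ?_,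
      fun m ψ hψ => ?_⟩
    · rw [extendTensors_apply]
      exact fun h0 => hn (Subtype.ext h0)
    · have := extendTensors_apply (fun n => (x n : (Fin n.val → Fin 4) → ℝ))
        ⟨k, Nat.lt_succ_iff.2 hk⟩
      simp only at this
      rw [this]
      exact (x _).2
    · simp only [extendTensors_apply]
      exact hsys m ψ hψ

lemma regularOnRay_kineticF (hN : 1 ≤ N) (lam : ℝ) {K : ℝ} (hK : 0 < K) (hl : mink l l < 0) :
    RegularOnRay (kineticF N K) lam l :=
  ⟨fun _ _ => (contDiff_kineticF N K).contDiffAt, integrableOn_kineticF hN lam hK hl⟩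

end

end UltraRel

end

theorem mainTheorem1 (N : ℕ) (hN : 1 ≤ N)
    (lam : ℝ) (l : Fin 4 → ℝ) (hl : UltraRel.mink l l < 0) (hl0 : 0 < l 0)
    (ξ η : Fin 4 → ℝ) (hξ : UltraRel.mink ξ ξ = -1) (hη : UltraRel.mink η η = 1)
    (hξη : UltraRel.mink η ξ = 0) (K : ℝ) (hK : 0 < K) :
    -- for each `p`, the eigenvalues are those of the blocks, whatever the coefficients are
    (∀ p, p ≤ N → ∀ G : Matrix (Fin (N + 1)) (Fin (N + 1)) ℝ,
      (∀ e, p + e ≤ N → UltraRel.TrailingNonsingular G (p + e)) →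
      UltraRel.charEigenvalues p G (UltraRel.velocity l) ξ η =
        ⋃ e ∈ Finset.range (N - p + 1),
          UltraRel.blockEigenvalues p e (UltraRel.velocity l) ξ η) ∧
    -- the kinetic model
    (UltraRel.coeffG (UltraRel.kineticF N K) lam l).PosDef ∧
    (∀ j, j ≤ N →
      UltraRel.TrailingNonsingular (UltraRel.coeffG (UltraRel.kineticF N K) lam l) j) ∧
    -- every macroscopic model
    (∀ F : (Fin (N + 1) → ℝ) → ℝ,
      (∀ x : ℝ, 0 < x → ContDiffAt ℝ 2 F (UltraRel.rayPoint N lam x)) →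
      (∀ m n : Fin (N + 1), MeasureTheory.IntegrableOn
        (fun ρ : ℝ => UltraRel.secondPartial F m n
          (UltraRel.rayPoint N lam (ρ * UltraRel.gam l)) * ρ ^ (m.val + n.val + 2))
        (Set.Ioi 0)) →
      UltraRel.HyperbolicityCondOne F (UltraRel.equilibrium lam l) (UltraRel.velocity l) →
      (∀ j, j ≤ N → UltraRel.TrailingNonsingular (UltraRel.coeffG F lam l) j) ∧
      (∀ p, p ≤ N →
        UltraRel.charEigenvalues p (UltraRel.coeffG F lam l) (UltraRel.velocity l) ξ η =
          UltraRel.charEigenvalues p (UltraRel.coeffG (UltraRel.kineticF N K) lam l)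
            (UltraRel.velocity l) ξ η) ∧
      UltraRel.waveSpeeds F (UltraRel.equilibrium lam l) ξ η =
        UltraRel.waveSpeeds (UltraRel.kineticF N K) (UltraRel.equilibrium lam l) ξ η) := by
  have hu := UltraRel.isFuture_velocity hl hl0
  have hpos := UltraRel.posDef_coeffG_kineticF hN lam hK hl
  have hkin := UltraRel.trailingNonsingular_of_posDef hpos
  have hreg := UltraRel.regularOnRay_kineticF hN lam hK hl
  refine ⟨fun p hp G hG => UltraRel.charEigenvalues_eq_iUnion hp hG _ ξ η, hpos,
    fun j _ => hkin j, fun F hF hFi hyp => ?_⟩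
  have hFreg : UltraRel.RegularOnRay F lam l := ⟨hF, hFi⟩
  have hFG := UltraRel.trailingNonsingular_of_hyperbolicity hFreg hl hu hyp
  have hinj : ∀ n : Fin (N + 1), ∀ T ∈ UltraRel.tracelessSymm n.val,
      UltraRel.tensorFn hu n T = 0 → T = 0 := fun n _ hT h0 =>
    UltraRel.tensorFn_injOn_of_hyperbolicity hFreg hl hu hyp n hT h0
  refine ⟨fun j _ => hFG j, fun p hp => ?_, Set.ext fun c => ?_⟩
  · rw [UltraRel.charEigenvalues_eq_iUnion hp fun e _ => hFG _,
      UltraRel.charEigenvalues_eq_iUnion hp fun e _ => hkin _]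
  · rw [UltraRel.mem_waveSpeeds_iff hFreg hl hu hinj fun j _ => hFG j,
      UltraRel.mem_waveSpeeds_iff hreg hl hu hinj fun j _ => hkin j]
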